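/- **Proposition (no $\mathsf E_T$ is extremal).** Let $\mathcal H$ be a complex Hilbert space with an orthonormal basis $\{|n\rangle : n\in\mathbb N\}$, $\mathbb N=\{0,1,2,\dots\}$, let $\mathbb T=\{t\in\mathbb C:|t|=1\}$, and let $U$ be the unitary representation of $\mathbb T$ with $U(t)|n\rangle=t^n|n\rangle$. A *phase observable* is a map $\mathsf E$ from the Borel sets of $\mathbb T$ to the bounded operators on $\mathcal H$ with $0\le \mathsf E(X)\le I$ and $\mathsf E(\mathbb T)=I$, which is $\sigma$-additive in the weak operator topology and satisfies $U(t)\mathsf E(X)U(t)^*=\mathsf E(tX)$ for all $t\in\mathbb T$ and all Borel sets $X$. A positive semidefinite matrix $(c_{m,n})_{m,n\in\mathbb N}$ with $c_{n,n}=1$ for all $n$ is the *phase matrix* of $\mathsf E$ if $$\langle m|\mathsf E(X)|n\rangle=c_{m,n}\int_{\arg X}e^{i(m-n)\theta}\,\frac{d\theta}{2\pi}\qquad\text{for all } m,n\in\mathbb N \text{ and all Borel } X\subseteq\mathbb T,$$ where $\arg X=\{\theta\in[0,2\pi): e^{i\theta}\in X\}$. Its *rank* is the dimension of a Hilbert space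 $\mathcal K$ containing a total sequence of unit vectors $\eta_n$ with $c_{m,n}=\langle\eta_m|\eta_n\rangle$. Let $a|n\rangle=\sqrt n\,|n-1\rangle$, $a^*|n\rangle=\sqrt{n+1}\,|n+1\rangle$, and let $D(z)=e^{za^*-\overline z a}$, $z\in\mathbb C$, be the shift operators. Let $T=\sum_{n}\lambda_n|n\rangle\langle n|$ with $\lambda_n\ge0$ and $\sum_n\lambda_n=1$ be a diagonal state. Then the formula $$\mathsf E_T(X)=\frac1\pi\int_{\arg X}\int_0^\infty D(re^{i\theta})\,T\,D(re^{i\theta})^*\,r\,dr\,d\theta\qquad\text{(weakly)}$$ defines a phase observable $\mathsf E_T$. It has a phase matrix all of whose entries are real and whose rank is infinite, and $\mathsf E_T$ is not an extreme point of the convex set of all phase observables. -/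

import Mathlib

namespace PhaseObs

open MeasureTheory Filter Topology
open scoped Pointwise ComplexConjugate ComplexOrder

set_option linter.unusedSectionVars false

noncomputable section

instance circleMeasurableSpace : MeasurableSpace Circle := borel Circle

instance circleBorelSpace : BorelSpace Circle := ⟨rfl⟩

/-- The Borel subsets of the torus `𝕋 = {t ∈ ℂ : |t| = 1}`. -/
abbrev BorelSet : Type := {X : Set Circle // MeasurableSet X}

/-- The rotated Borel set `t X`. -/
def rotate (t : Circle) (X : BorelSet) : BorelSet := ⟨t • (X : Set Circle), X.2.const_smul t⟩

/-- `arg X = {θ ∈ [0, 2π) : e^{iθ} ∈ X}`. -/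
def argSet (X : BorelSet) : Set ℝ :=
  {θ : ℝ | θ ∈ Set.Ico 0 (2 * Real.pi) ∧ Circle.exp θ ∈ (X : Set Circle)}

variable {H : Type*} [NormedAddCommGroup H] [InnerProductSpace ℂ H] [CompleteSpace H]

/-- Set functions from the Borel sets of the torus to the bounded operators. -/
abbrev OperatorSetFunction (H : Type*) [NormedAddCommGroup H] [InnerProductSpace ℂ H] : Type _ :=
  BorelSet → (H →L[ℂ] H)

/-- An observable with outcome set `𝕋`: `0 ≤ E(X) ≤ I`, `E(𝕋) = I`, and `E` is σ-additive in the
weak operator topology. -/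
structure IsObservable (E : OperatorSetFunction H) : Prop where
  nonneg : ∀ X, 0 ≤ E X
  le_one : ∀ X, E X ≤ 1
  univ : E ⟨Set.univ, MeasurableSet.univ⟩ = 1
  sigma_additive : ∀ X : ℕ → BorelSet, Pairwise (fun i j => Disjoint (X i : Set Circle) (X j)) →
    ∀ φ ψ : H, HasSum (fun i => inner ℂ φ (E (X i) ψ))
      (inner ℂ φ (E ⟨⋃ i, (X i : Set Circle), MeasurableSet.iUnion fun i => (X i).2⟩ ψ))

theorem orthonormal_circle_smul (b : HilbertBasis ℕ ℂ H) (t : Circle) :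
    Orthonormal ℂ (fun n => ((t : ℂ) ^ n) • b n) := by
  have h := b.orthonormal
  refine ⟨fun n => ?_, fun i j hij => ?_⟩
  · rw [norm_smul, h.1 n, norm_pow, Circle.norm_coe, one_pow, one_mul]
  · change inner ℂ (((t : ℂ) ^ i) • b i) (((t : ℂ) ^ j) • b j) = 0
    rw [inner_smul_left, inner_smul_right, h.2 hij, mul_zero, mul_zero]

theorem span_circle_smul (b : HilbertBasis ℕ ℂ H) (t : Circle) :
    ⊤ ≤ (Submodule.span ℂ
      (Set.range (fun n => ((t : ℂ) ^ n) • b n))).topologicalClosure := by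
  rw [← b.dense_span]
  refine Submodule.topologicalClosure_mono (Submodule.span_le.2 ?_)
  rintro _ ⟨n, rfl⟩
  have h : ((t : ℂ) ^ n) • b n ∈ Submodule.span ℂ
      (Set.range (fun n => ((t : ℂ) ^ n) • b n)) :=
    Submodule.subset_span ⟨n, rfl⟩
  have h2 := Submodule.smul_mem _ ((t : ℂ) ^ n)⁻¹ h
  rwa [smul_smul, inv_mul_cancel₀ (pow_ne_zero n (Circle.coe_ne_zero t)), one_smul] at h2

/-- The number representation: `U(t)` is the unitary operator carrying the orthonormal basis
`|n⟩` to the orthonormal basis `tⁿ |n⟩`. -/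
def numberRep (b : HilbertBasis ℕ ℂ H) (t : Circle) : H ≃ₗᵢ[ℂ] H :=
  b.repr.trans
    (HilbertBasis.mk (orthonormal_circle_smul b t) (span_circle_smul b t)).repr.symm

theorem numberRep_apply_basis (b : HilbertBasis ℕ ℂ H) (t : Circle) (n : ℕ) :
    numberRep b t (b n) = ((t : ℂ) ^ n) • b n := by
  rw [numberRep, LinearIsometryEquiv.trans_apply, HilbertBasis.repr_self,
    HilbertBasis.repr_symm_single, HilbertBasis.coe_mk]

/-- A phase observable: an observable covariant under the number representation,
`U(t) E(X) U(t)* = E(tX)`. -/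
structure IsPhaseObservable (b : HilbertBasis ℕ ℂ H) (E : OperatorSetFunction H) : Prop
    extends IsObservable E where
  covariant : ∀ (t : Circle) (X : BorelSet),
    (numberRep b t : H →L[ℂ] H) ∘L E X ∘L ContinuousLinearMap.adjoint (numberRep b t : H →L[ℂ] H)
      = E (rotate t X)

/-- The (convex) set of all phase observables. -/
def phaseObservables (b : HilbertBasis ℕ ℂ H) : Set (OperatorSetFunction H) :=
  {E | IsPhaseObservable b E}

/-- Phase matrices: positive semidefinite complex `ℕ × ℕ`-matrices with unit diagonal. -/
def IsPhaseMatrix (c : Matrix ℕ ℕ ℂ) : Prop :=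
  c.PosSemidef ∧ ∀ n, c n n = 1

/-- `c` is the phase matrix of `E`:
`⟨m|E(X)|n⟩ = c_{m,n} ∫_{arg X} e^{i(m-n)θ} dθ/2π`. -/
def HasPhaseMatrix (b : HilbertBasis ℕ ℂ H) (E : OperatorSetFunction H)
    (c : Matrix ℕ ℕ ℂ) : Prop :=
  IsPhaseMatrix c ∧ ∀ (X : BorelSet) (m n : ℕ),
    inner ℂ (b m) (E X (b n)) =
      c m n * ((∫ θ in argSet X, Complex.exp (Complex.I * ((m : ℂ) - (n : ℂ)) * (θ : ℂ)))
        / (2 * (Real.pi : ℂ)))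

/-- The matrix `c` is the Gram matrix `c_{m,n} = ⟨η_m|η_n⟩` of a total sequence of unit vectors
`η_n` of the Hilbert space `K`. The dimension of `K`, which is determined by `c`, is the rank
of `c`. -/
structure IsRealization (c : Matrix ℕ ℕ ℂ) {K : Type*} [NormedAddCommGroup K]
    [InnerProductSpace ℂ K] (η : ℕ → K) : Prop where
  unit : ∀ n, ‖η n‖ = 1
  total : (Submodule.span ℂ (Set.range η)).topologicalClosure = ⊤
  gram : ∀ m n, c m n = inner ℂ (η m) (η n)

/-- The rank of the phase matrix `c` is infinite. -/
def HasInfiniteRank (c : Matrix ℕ ℕ ℂ) : Prop :=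
  ∃ (K : Type) (_ : NormedAddCommGroup K) (_ : InnerProductSpace ℂ K) (_ : CompleteSpace K)
    (η : ℕ → K), IsRealization c η ∧ ¬ FiniteDimensional ℂ K

/-- Diagonal states `T = ∑ₙ λₙ |n⟩⟨n|` with `λₙ ≥ 0` and `∑ₙ λₙ = 1`. -/
def diagonalStates (b : HilbertBasis ℕ ℂ H) : Set (H →L[ℂ] H) :=
  {T | ∃ lam : ℕ → ℝ, (∀ n, 0 ≤ lam n) ∧ HasSum lam 1 ∧
    HasSum (fun n => (lam n : ℂ) • InnerProductSpace.rankOne ℂ (b n) (b n)) T}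

/-- The finite linear combination of number states with given coefficients. -/
def numberVec (b : HilbertBasis ℕ ℂ H) : (ℕ →₀ ℂ) →ₗ[ℂ] H := Finsupp.linearCombination ℂ b

/-- The lowering operator `a = ∑ₙ √(n+1) |n⟩⟨n+1|` on finite linear combinations of number
states; thus `a |n⟩ = √n |n-1⟩`, which is `0` for `n = 0`. -/
def lowering : (ℕ →₀ ℂ) →ₗ[ℂ] (ℕ →₀ ℂ) :=
  Finsupp.linearCombination ℂ fun n => Finsupp.single (n - 1) ((Real.sqrt n : ℝ) : ℂ)

/-- The raising operator `a* = ∑ₙ √(n+1) |n+1⟩⟨n|` on finite linear combinations of number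
states. -/
def raising : (ℕ →₀ ℂ) →ₗ[ℂ] (ℕ →₀ ℂ) :=
  Finsupp.linearCombination ℂ fun n => Finsupp.single (n + 1) ((Real.sqrt (n + 1) : ℝ) : ℂ)

/-- The skew-symmetric operator `z a* - z̄ a`. -/
def shiftGen (z : ℂ) : (ℕ →₀ ℂ) →ₗ[ℂ] (ℕ →₀ ℂ) := z • raising - conj z • lowering

/-- The exponential series `∑ₖ (z a* - z̄ a)ᵏ |n⟩ / k!` (norm-convergent in `H`: number states are
analytic vectors of `z a* - z̄ a`). -/
def shiftSeries (b : HilbertBasis ℕ ℂ H) (z : ℂ) (n : ℕ) : H :=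
  ∑' k : ℕ, ((k.factorial : ℂ)⁻¹) • numberVec b ((shiftGen z ^ k) (Finsupp.single n 1))

/-- The shift operator `D(z) = e^{z a* - z̄ a}`: the continuous linear operator on `H` given by the
exponential series on the span of the number states. -/
def shift (b : HilbertBasis ℕ ℂ H) (z : ℂ) : H →L[ℂ] H :=
  (Finsupp.linearCombination ℂ (shiftSeries b z)).extendOfNorm (numberVec b)



theorem shiftGen_single (z : ℂ) (n : ℕ) :
    shiftGen z (Finsupp.single n 1) =
      (z * (Real.sqrt (n + 1) : ℝ)) • Finsupp.single (n + 1) (1 : ℂ)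
        - (conj z * (Real.sqrt n : ℝ)) • Finsupp.single (n - 1) (1 : ℂ) := by
  simp [shiftGen, raising, lowering, Finsupp.linearCombination_single]

theorem shiftGen_pow_norm_le (b : HilbertBasis ℕ ℂ H) (z : ℂ) (k n : ℕ) :
    ‖numberVec b ((shiftGen z ^ k) (Finsupp.single n 1))‖ ≤
      (2 * ‖z‖) ^ k * Real.sqrt ((n + 1).ascFactorial k) := by
  induction k generalizing n with
  | zero => simp [numberVec, b.orthonormal.1 n]
  | succ k ih =>
    rw [pow_succ, Module.End.mul_apply, shiftGen_single, map_sub, map_smul, map_smul, map_sub,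
      map_smul, map_smul]
    refine (norm_sub_le _ _).trans ?_
    rw [norm_smul, norm_smul, norm_mul, norm_mul, RCLike.norm_conj, Complex.norm_real,
      Complex.norm_real, Real.norm_of_nonneg (Real.sqrt_nonneg _),
      Real.norm_of_nonneg (Real.sqrt_nonneg _)]
    have h1 : Real.sqrt (n + 1) * Real.sqrt ((n + 1 + 1).ascFactorial k) =
        Real.sqrt ((n + 1).ascFactorial (k + 1)) := by
      rw [← Real.sqrt_mul (by positivity)]
      congr 1
      have := Nat.succ_ascFactorial (n + 1) k
      rw [Nat.ascFactorial_succ, ← this]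
      push_cast
      rfl
    have h2 : Real.sqrt n * Real.sqrt ((n - 1 + 1).ascFactorial k) ≤
        Real.sqrt ((n + 1).ascFactorial (k + 1)) := by
      rw [← Real.sqrt_mul (by positivity)]
      apply Real.sqrt_le_sqrt
      rcases n with _ | n
      · simp
      · rw [Nat.add_sub_cancel]
        have h3 : (n + 1) * (n + 1).ascFactorial k ≤ (n + 1 + 1).ascFactorial (k + 1) := by
          rw [Nat.ascFactorial_succ]
          exact Nat.mul_le_mul (by omega) (Nat.ascFactorial_le k (by omega))
        exact_mod_cast h3
    have e1 := mul_le_mul_of_nonneg_left (ih (n + 1))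
      (by positivity : 0 ≤ ‖z‖ * Real.sqrt (n + 1))
    have e2 := mul_le_mul_of_nonneg_left (ih (n - 1)) (by positivity : 0 ≤ ‖z‖ * Real.sqrt n)
    have e3 := mul_le_mul_of_nonneg_left h2 (by positivity : 0 ≤ ‖z‖ * (2 * ‖z‖) ^ k)
    have e4 : ‖z‖ * (2 * ‖z‖) ^ k * (Real.sqrt (n + 1) * Real.sqrt ((n + 1 + 1).ascFactorial k))
      = ‖z‖ * (2 * ‖z‖) ^ k * Real.sqrt ((n + 1).ascFactorial (k + 1)) := by rw [h1]
    rw [pow_succ]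
    linarith

theorem summable_shiftSeries_single (b : HilbertBasis ℕ ℂ H) (z : ℂ) (n : ℕ) :
    Summable fun k : ℕ =>
      ‖((k.factorial : ℂ)⁻¹) • numberVec b ((shiftGen z ^ k) (Finsupp.single n 1))‖ := by
  have hs : Summable fun k : ℕ =>
      (2 * ((2 * ‖z‖) ^ 2 * (n + 1))) ^ k / (k.factorial : ℝ) + (1 / 2 : ℝ) ^ k :=
    (Real.summable_pow_div_factorial _).add
      (summable_geometric_of_lt_one (by norm_num) (by norm_num))
  refine Summable.of_nonneg_of_le (fun _ => norm_nonneg _) (fun k => ?_) hs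
  have hk : (0 : ℝ) < k.factorial := by exact_mod_cast k.factorial_pos
  rw [norm_smul, norm_inv, Complex.norm_natCast]
  refine (mul_le_mul_of_nonneg_left (shiftGen_pow_norm_le b z k n) (by positivity)).trans ?_
  have hp : 0 ≤ (2 * ((2 * ‖z‖) ^ 2 * (n + 1))) ^ k / (k.factorial : ℝ) := by positivity
  have hq : 0 ≤ (1 / 2 : ℝ) ^ k := by positivity
  refine abs_le_of_sq_le_sq' ?_ (by positivity) |>.2
  have hasc : ((n + 1).ascFactorial k : ℝ) ≤ k.factorial * ((n : ℝ) + 1) ^ k := by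
    exact_mod_cast Nat.ascFactorial_le_factorial_mul_pow (n + 1) k
  have h1 : ((k.factorial : ℝ)⁻¹ * ((2 * ‖z‖) ^ k * Real.sqrt ((n + 1).ascFactorial k))) ^ 2 ≤
      (2 * ((2 * ‖z‖) ^ 2 * (n + 1))) ^ k / (k.factorial : ℝ) * (1 / 2 : ℝ) ^ k := by
    rw [mul_pow, mul_pow ((2 * ‖z‖) ^ k), Real.sq_sqrt (by positivity)]
    calc ((k.factorial : ℝ)⁻¹) ^ 2 * (((2 * ‖z‖) ^ k) ^ 2 * ((n + 1).ascFactorial k : ℝ))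
        ≤ ((k.factorial : ℝ)⁻¹) ^ 2 *
          (((2 * ‖z‖) ^ k) ^ 2 * (k.factorial * ((n : ℝ) + 1) ^ k)) := by gcongr
      _ = _ := by
        rw [mul_pow (2 : ℝ) ((2 * ‖z‖) ^ 2 * (n + 1)), mul_pow ((2 * ‖z‖) ^ 2), ← pow_mul, ← pow_mul, mul_comm k 2, one_div,
          inv_pow]
        field_simp
        rw [mul_assoc, ← mul_pow]
        norm_num
  nlinarith [mul_nonneg hp hq]

theorem summable_shiftSeries (b : HilbertBasis ℕ ℂ H) (z : ℂ) (f : ℕ →₀ ℂ) :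
    Summable fun k : ℕ => ‖((k.factorial : ℂ)⁻¹) • numberVec b ((shiftGen z ^ k) f)‖ := by
  induction f using Finsupp.induction_linear with
  | zero => simp
  | add f g hf hg =>
    refine Summable.of_nonneg_of_le (fun _ => norm_nonneg _) (fun k => ?_) (hf.add hg)
    rw [map_add, map_add, smul_add]
    exact norm_add_le _ _
  | single n c =>
    refine ((summable_shiftSeries_single b z n).mul_left ‖c‖).congr fun k => ?_
    rw [← norm_smul, smul_comm, ← map_smul (numberVec b) c, ← map_smul _ c, Finsupp.smul_single,
      smul_eq_mul, mul_one]

theorem hasSum_linearCombination_shiftSeries (b : HilbertBasis ℕ ℂ H) (z : ℂ) (f : ℕ →₀ ℂ) :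
    HasSum (fun k : ℕ => ((k.factorial : ℂ)⁻¹) • numberVec b ((shiftGen z ^ k) f))
      (Finsupp.linearCombination ℂ (shiftSeries b z) f) := by
  induction f using Finsupp.induction_linear with
  | zero => simp
  | add f g hf hg => simpa [map_add, smul_add] using hf.add hg
  | single n c =>
    have h := ((summable_shiftSeries_single b z n).of_norm.hasSum).const_smul c
    rw [Finsupp.linearCombination_single]
    rw [shiftSeries]
    convert h using 2 with k
    rw [smul_comm c, ← map_smul (numberVec b) c, ← map_smul _ c, Finsupp.smul_single, smul_eq_mul, mul_one]

theorem inner_numberVec (b : HilbertBasis ℕ ℂ H) (m n : ℕ) (x y : ℂ) :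
    inner ℂ (numberVec b (Finsupp.single m x)) (numberVec b (Finsupp.single n y)) =
      if m = n then conj x * y else 0 := by
  rw [numberVec, Finsupp.linearCombination_single, Finsupp.linearCombination_single,
    inner_smul_left, inner_smul_right, orthonormal_iff_ite.1 b.orthonormal m n]
  split_ifs <;> simp

theorem inner_raising (b : HilbertBasis ℕ ℂ H) (f g : ℕ →₀ ℂ) :
    inner ℂ (numberVec b (raising f)) (numberVec b g) =
      inner ℂ (numberVec b f) (numberVec b (lowering g)) := by
  induction f using Finsupp.induction_linear with
  | zero => simp
  | add f f' hf hf' => simp only [map_add, inner_add_left, hf, hf']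
  | single m x =>
    induction g using Finsupp.induction_linear with
    | zero => simp
    | add g g' hg hg' => simp only [map_add, inner_add_right, hg, hg']
    | single n y =>
      rw [raising, lowering, Finsupp.linearCombination_single, Finsupp.linearCombination_single,
        Finsupp.smul_single, Finsupp.smul_single, inner_numberVec, inner_numberVec]
      rcases n with _ | n
      · simp
      · by_cases h : m = n
        · subst h
          simp
          ring
        · simp [h]

theorem inner_shiftGen (b : HilbertBasis ℕ ℂ H) (z : ℂ) (f g : ℕ →₀ ℂ) :
    inner ℂ (numberVec b (shiftGen z f)) (numberVec b g) =
      - inner ℂ (numberVec b f) (numberVec b (shiftGen z g)) := by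
  have h : inner ℂ (numberVec b (lowering f)) (numberVec b g) =
      inner ℂ (numberVec b f) (numberVec b (raising g)) := by
    rw [← inner_conj_symm, ← inner_raising, inner_conj_symm]
  simp only [shiftGen, LinearMap.sub_apply, LinearMap.smul_apply, map_sub, map_smul,
    inner_sub_left, inner_sub_right, inner_smul_left, inner_smul_right, inner_raising, h,
    Complex.conj_conj]
  ring

theorem inner_shiftGen_pow (b : HilbertBasis ℕ ℂ H) (z : ℂ) (j : ℕ) (f g : ℕ →₀ ℂ) :
    inner ℂ (numberVec b ((shiftGen z ^ j) f)) (numberVec b g) =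
      (-1) ^ j * inner ℂ (numberVec b f) (numberVec b ((shiftGen z ^ j) g)) := by
  induction j generalizing g with
  | zero => simp
  | succ j ih =>
    rw [pow_succ', Module.End.mul_apply, inner_shiftGen, ih, ← Module.End.mul_apply, ← pow_succ,
      ← pow_succ', pow_succ (-1 : ℂ)]
    ring

theorem sum_antidiagonal_neg_one (n : ℕ) (hn : n ≠ 0) :
    ∑ p ∈ Finset.HasAntidiagonal.antidiagonal n,
      ((p.1.factorial : ℂ)⁻¹ * (p.2.factorial : ℂ)⁻¹ * (-1) ^ p.1) = 0 := by
  have h := (Commute.all (-1 : ℂ) 1).add_pow' n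
  rw [neg_add_cancel, zero_pow hn] at h
  have hn' : (n.factorial : ℂ) ≠ 0 := by exact_mod_cast n.factorial_ne_zero
  refine (mul_eq_zero.1 (?_ : (n.factorial : ℂ) * _ = 0)).resolve_left hn'
  rw [h, Finset.mul_sum]
  refine Finset.sum_congr rfl fun p hp => ?_
  obtain rfl := Finset.HasAntidiagonal.mem_antidiagonal.1 hp
  have e : (((p.1 + p.2).choose p.1 : ℕ) : ℂ) * (p.1.factorial : ℂ) * (p.2.factorial : ℂ) =
      ((p.1 + p.2).factorial : ℂ) := by
    have := Nat.add_choose_mul_factorial_mul_factorial p.1 p.2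
    rw [Nat.choose_symm_add, ← this]
    push_cast
    rfl
  have h1 : (p.1.factorial : ℂ) ≠ 0 := by exact_mod_cast p.1.factorial_ne_zero
  have h2 : (p.2.factorial : ℂ) ≠ 0 := by exact_mod_cast p.2.factorial_ne_zero
  rw [← e, one_pow, mul_one, nsmul_eq_mul]
  field_simp

theorem norm_linearCombination_shiftSeries (b : HilbertBasis ℕ ℂ H) (z : ℂ) (f : ℕ →₀ ℂ) :
    ‖Finsupp.linearCombination ℂ (shiftSeries b z) f‖ = ‖numberVec b f‖ := by
  have hs := hasSum_linearCombination_shiftSeries b z f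
  set F := Finsupp.linearCombination ℂ (shiftSeries b z) f
  set u : ℕ → H := fun k => ((k.factorial : ℂ)⁻¹) • numberVec b ((shiftGen z ^ k) f) with hu
  have hn : Summable fun k => ‖u k‖ := summable_shiftSeries b z f
  have hsum : Summable fun p : ℕ × ℕ => inner ℂ (u p.1) (u p.2) := by
    refine Summable.of_norm_bounded (hn.mul_of_nonneg hn (fun _ => norm_nonneg _)
      (fun _ => norm_nonneg _)) fun p => norm_inner_le_norm _ _
  have h1 : ∑' p : ℕ × ℕ, inner ℂ (u p.1) (u p.2) = inner ℂ F F := by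
    rw [hsum.tsum_prod]
    have e1 : ∀ j, ∑' k, inner ℂ (u j) (u k) = inner ℂ (u j) F := fun j =>
      (hs.mapL (innerSL ℂ (u j))).tsum_eq
    simp_rw [e1]
    have e2 := hs.mapL (innerSL ℂ F)
    have e3 : HasSum (fun j => conj (inner ℂ F (u j))) (conj (inner ℂ F F)) :=
      (Complex.hasSum_conj'.2 e2)
    simp only [inner_conj_symm] at e3
    exact e3.tsum_eq
  have hanti : ∀ n : ℕ, ∑ p ∈ Finset.HasAntidiagonal.antidiagonal n, inner ℂ (u p.1) (u p.2) =
      if n = 0 then inner ℂ (numberVec b f) (numberVec b f) else 0 := by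
    intro n
    have e : ∀ p ∈ Finset.HasAntidiagonal.antidiagonal n, inner ℂ (u p.1) (u p.2) =
        ((p.1.factorial : ℂ)⁻¹ * (p.2.factorial : ℂ)⁻¹ * (-1) ^ p.1) *
          inner ℂ (numberVec b f) (numberVec b ((shiftGen z ^ n) f)) := by
      intro p hp
      rw [hu]
      simp only [inner_smul_left, inner_smul_right, inner_shiftGen_pow]
      rw [← Module.End.mul_apply, ← pow_add, Finset.HasAntidiagonal.mem_antidiagonal.1 hp]
      simp
      ring
    rw [Finset.sum_congr rfl e, ← Finset.sum_mul]
    split_ifs with h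
    · subst h; simp
    · rw [sum_antidiagonal_neg_one n h, zero_mul]
  have h2 : ∑' p : ℕ × ℕ, inner ℂ (u p.1) (u p.2) = inner ℂ (numberVec b f) (numberVec b f) := by
    rw [← Finset.HasAntidiagonal.sigmaAntidiagonalEquivProd.tsum_eq]
    refine ((Finset.HasAntidiagonal.sigmaAntidiagonalEquivProd.summable_iff.2 hsum).tsum_sigma'
      (fun n => (hasSum_fintype _).summable)).trans ?_
    rw [tsum_eq_single 0]
    · rw [tsum_fintype]
      have := hanti 0
      rw [if_pos rfl, ← Finset.sum_coe_sort] at this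
      exact this
    · intro n hn0
      rw [tsum_fintype]
      have := hanti n
      rw [if_neg hn0, ← Finset.sum_coe_sort] at this
      exact this
  have h3 : inner ℂ F F = inner ℂ (numberVec b f) (numberVec b f) := h1.symm.trans h2
  rw [inner_self_eq_norm_sq_to_K, inner_self_eq_norm_sq_to_K] at h3
  have h4 : ‖F‖ ^ 2 = ‖numberVec b f‖ ^ 2 := by exact_mod_cast h3
  exact (sq_eq_sq₀ (norm_nonneg _) (norm_nonneg _)).1 h4

theorem denseRange_numberVec (b : HilbertBasis ℕ ℂ H) : DenseRange (numberVec b) := by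
  have h := b.dense_span
  rw [← Finsupp.range_linearCombination, ← Submodule.dense_iff_topologicalClosure_eq_top] at h
  exact h

/-- `shift b z` is an isometry that is given on number states by the (convergent) exponential
series. -/
theorem shift_isometry (b : HilbertBasis ℕ ℂ H) (z : ℂ) (x : H) : ‖shift b z x‖ = ‖x‖ := by
  refine (denseRange_numberVec b).induction_on x (isClosed_eq (by fun_prop) (by fun_prop))
    fun f => ?_
  rw [shift, LinearMap.extendOfNorm_eq (denseRange_numberVec b)
    ⟨1, fun f => by rw [norm_linearCombination_shiftSeries, one_mul]⟩,
    norm_linearCombination_shiftSeries]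

theorem hasSum_shift (b : HilbertBasis ℕ ℂ H) (z : ℂ) (f : ℕ →₀ ℂ) :
    HasSum (fun k : ℕ => ((k.factorial : ℂ)⁻¹) • numberVec b ((shiftGen z ^ k) f))
      (shift b z (numberVec b f)) := by
  rw [shift, LinearMap.extendOfNorm_eq (denseRange_numberVec b)
    ⟨1, fun f => by rw [norm_linearCombination_shiftSeries, one_mul]⟩]
  exact hasSum_linearCombination_shiftSeries b z f

/-- The integrand `⟨φ| D(re^{iθ}) T D(re^{iθ})* |ψ⟩ r` as a function of `(θ, r)`. -/
def phaseSpaceIntegrand (b : HilbertBasis ℕ ℂ H) (T : H →L[ℂ] H) (φ ψ : H) (p : ℝ × ℝ) : ℂ :=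
  inner ℂ φ ((shift b ((p.2 : ℂ) * Complex.exp (Complex.I * (p.1 : ℂ))) ∘L T ∘L
    ContinuousLinearMap.adjoint (shift b ((p.2 : ℂ) * Complex.exp (Complex.I * (p.1 : ℂ))))) ψ)
    * (p.2 : ℂ)

/-- `E(X) = π⁻¹ ∫_{arg X} ∫_0^∞ D(re^{iθ}) T D(re^{iθ})* r dr dθ` weakly for all Borel sets `X`;
the convergence of the integrals is part of the assertion. -/
def IsGeneratedBy (b : HilbertBasis ℕ ℂ H) (T : H →L[ℂ] H) (E : OperatorSetFunction H) : Prop :=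
  ∀ (X : BorelSet) (φ ψ : H),
    IntegrableOn (phaseSpaceIntegrand b T φ ψ) (argSet X ×ˢ Set.Ioi (0 : ℝ)) ∧
    inner ℂ φ (E X ψ) =
      (Real.pi : ℂ)⁻¹ * ∫ p in argSet X ×ˢ Set.Ioi (0 : ℝ), phaseSpaceIntegrand b T φ ψ p

theorem IsGeneratedBy.unique {b : HilbertBasis ℕ ℂ H} {T : H →L[ℂ] H}
    {E F : OperatorSetFunction H} (hE : IsGeneratedBy b T E) (hF : IsGeneratedBy b T F) :
    E = F := by
  funext X
  ext ψ
  exact ext_inner_left ℂ fun φ => by rw [(hE X φ ψ).2, (hF X φ ψ).2]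

/-- The phase observable `E_T` generated by `T`: the unique operator valued set function
that is weakly given by the integral formula. -/
def generatedObservable (b : HilbertBasis ℕ ℂ H) (T : H →L[ℂ] H) : OperatorSetFunction H :=
  Classical.epsilon (IsGeneratedBy b T)

end

end PhaseObs

/-! Since `T` is diagonal, the weak integral for `E_T` separates in polar coordinates. For `|u| = 1`
one has `⟨m|D(ru)|k⟩ = u^m ū^k A_{m,k}(r)` with `A_{m,k}(r)` real (`inner_shift`), so in
`⟨m|D|k⟩⟨k|D*|n⟩` the phase coming from `k` cancels. What remains is `e^{i(m-n)θ}` times a real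
radial function. Hence `c_{m,n} = ∑_k λ_k ∫ 2r A_{m,k} A_{n,k} dr`, the real Gram matrix of the
vectors `η_n` with components `√λ_k √(2r) A_{n,k}(r)` (`radialVec`).

These are unit vectors because `∫ 2r A_{n,k}² dr = 1` (`integral_shiftAmp_sq`). They are linearly
independent because, for one `k` with `λ_k ≠ 0`, the functions `A_{n,k}` are a common Gaussian times
polynomials of distinct degrees `n + k`. So the rank is infinite.

Any sequence of unit vectors `η_n` yields a phase observable with Gram matrix as phase matrix, by
compressing multiplication by indicator functions along an isometry into square integrable
`K`-valued functions on the circle (`waveObservable`). The one built from `radialVec` is shown to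
satisfy the integral formula, first on number states and then on all of `H` by density and
positivity (`isGeneratedBy_waveObservable`). By uniqueness it is `E_T`.

Non-extremality needs only that the Gram matrix is real and that `η_0`, `η_1` are independent. Let
`x`, `y` be the real components of `η_n` along an orthonormal pair. Replacing them by the single
component `x ± iy` adds `±i` times a real antisymmetric matrix to the Gram matrix and keeps the unit
diagonal. The two resulting phase observables are distinct from `E_T` and have it as midpoint
(`waveObservable_notMem_extremePoints`). -/

namespace PhaseObs

open MeasureTheory Filter Topology
open scoped Pointwise ComplexConjugate ComplexOrder Polynomial

set_option linter.unusedSectionVars false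

noncomputable section

variable {H : Type*} [NormedAddCommGroup H] [InnerProductSpace ℂ H] [CompleteSpace H]

/-! ### Polynomials behind the matrix elements of the shift operators -/

/-- The polynomials `p_{m,n}` with `⟨m|D(r)|n⟩ = e^{-r²/2} p_{m,n}(r) / √(m! n!)` for real `r`. -/
def shiftPoly (R : Type*) [CommRing R] : ℕ → ℕ → R[X]
  | 0, n => (-Polynomial.X) ^ n
  | m + 1, n => (n : R[X]) * shiftPoly R m (n - 1) + Polynomial.X * shiftPoly R m n

section ShiftPoly

variable {R : Type*} [CommRing R]

theorem shiftPoly_succ_left (m n : ℕ) : shiftPoly R (m + 1) n =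
    (n : R[X]) * shiftPoly R m (n - 1) + Polynomial.X * shiftPoly R m n := rfl

/-- The defining recursion encodes `a D = D (a + r)`. The first identity here encodes `D a* = (a* -
r) D`, and the second `[a*a, D] = r (a* D + D a)`. The induction step of each uses both, so they are
proved together. At index `0` the truncated subtraction is harmless because its coefficient
vanishes. -/
theorem shiftPoly_recurrence (m : ℕ) : ∀ n : ℕ,
    (m : R[X]) * shiftPoly R (m - 1) n =
        shiftPoly R m (n + 1) + Polynomial.X * shiftPoly R m n ∧
      Polynomial.X * ((m : R[X]) * shiftPoly R (m - 1) n) +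
          Polynomial.X * ((n : R[X]) * shiftPoly R m (n - 1)) =
        ((m : R[X]) - (n : R[X])) * shiftPoly R m n := by
  induction m with
  | zero =>
    intro n
    constructor
    · simp only [shiftPoly, Nat.cast_zero, zero_mul]
      ring
    · rcases n with _ | n
      · simp [shiftPoly]
      · simp [shiftPoly, pow_succ]
        ring
  | succ m ih =>
    intro n
    constructor
    · have h1 := (ih n).1
      have h2 := (ih n).2
      rw [shiftPoly_succ_left, shiftPoly_succ_left]
      simp only [Nat.add_sub_cancel]
      push_cast
      linear_combination (-1 : R[X]) * h2 + Polynomial.X * h1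
    · rcases n with _ | n
      · have h2 := (ih 0).2
        simp only [shiftPoly_succ_left, Nat.add_sub_cancel] at h2 ⊢
        push_cast at h2 ⊢
        ring
      · have h1 := (ih n).1
        have h2 := (ih n).2
        simp only [shiftPoly_succ_left, Nat.add_sub_cancel] at h1 h2 ⊢
        push_cast at h1 h2 ⊢
        linear_combination ((n : R[X]) + 1) * h2 - ((n : R[X]) + 1) * Polynomial.X * h1


theorem derivative_shiftPoly (m : ℕ) : ∀ n : ℕ, Polynomial.derivative (shiftPoly R m n) =
    (m : R[X]) * shiftPoly R (m - 1) n - (n : R[X]) * shiftPoly R m (n - 1) := by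
  induction m with
  | zero =>
    intro n
    simp [shiftPoly, Polynomial.derivative_pow]
  | succ m ih =>
    intro n
    rw [shiftPoly_succ_left]
    simp only [Polynomial.derivative_add, Polynomial.derivative_mul, Polynomial.derivative_natCast,
      Polynomial.derivative_X, ih, Nat.add_sub_cancel, shiftPoly_succ_left m (n - 1)]
    rcases m with _ | m
    · push_cast
      ring
    · simp only [shiftPoly_succ_left m n, Nat.add_sub_cancel]
      push_cast
      ring

theorem eval_zero_shiftPoly (m : ℕ) : ∀ n : ℕ,
    (shiftPoly R m n).eval 0 = if m = n then (m.factorial : R) else 0 := by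
  induction m with
  | zero =>
    intro n
    rcases n with _ | n <;> simp [shiftPoly]
  | succ m ih =>
    intro n
    rcases n with _ | n
    · simp [shiftPoly_succ_left]
    · simp only [shiftPoly_succ_left, Nat.add_sub_cancel, Polynomial.eval_add,
        Polynomial.eval_mul, Polynomial.eval_X, zero_mul, add_zero, ih, Polynomial.eval_natCast]
      by_cases h : m = n
      · subst h
        simp [Nat.factorial_succ]
      · simp [h]

theorem shiftPoly_right_zero (m : ℕ) : shiftPoly R m 0 = Polynomial.X ^ m := by
  induction m with
  | zero => simp [shiftPoly]
  | succ m ih => simp [shiftPoly_succ_left, ih, pow_succ']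

theorem map_shiftPoly {S : Type*} [CommRing S] (f : R →+* S) (m : ℕ) : ∀ n : ℕ,
    (shiftPoly R m n).map f = shiftPoly S m n := by
  induction m with
  | zero => intro n; simp [shiftPoly]
  | succ m ih => intro n; simp [shiftPoly_succ_left, ih]

theorem natDegree_shiftPoly_le (m : ℕ) : ∀ n : ℕ, (shiftPoly R m n).natDegree ≤ m + n := by
  induction m with
  | zero =>
    intro n
    have h := Polynomial.natDegree_pow_le_of_le (p := (-Polynomial.X : R[X])) (m := 1) n
      (by simpa using Polynomial.natDegree_X_le)
    simpa [shiftPoly] using h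
  | succ m ih =>
    intro n
    rw [shiftPoly_succ_left]
    refine Polynomial.natDegree_add_le_of_degree_le ?_ ?_
    · rw [← nsmul_eq_mul]
      exact (Polynomial.natDegree_smul_le _ _).trans ((ih _).trans (by omega))
    · refine Polynomial.natDegree_mul_le.trans ?_
      have := ih n
      have := Polynomial.natDegree_X_le (R := R)
      omega

theorem coeff_shiftPoly (m : ℕ) : ∀ n : ℕ, (shiftPoly R m n).coeff (m + n) = (-1) ^ n := by
  induction m with
  | zero =>
    intro n
    rw [shiftPoly, neg_pow, zero_add, ← map_one Polynomial.C, ← map_neg, ← map_pow,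
      Polynomial.coeff_C_mul_X_pow, if_pos rfl]
  | succ m ih =>
    intro n
    rw [shiftPoly_succ_left, Polynomial.coeff_add, add_right_comm, Polynomial.coeff_X_mul, ih,
      ← nsmul_eq_mul, Polynomial.coeff_smul, Polynomial.coeff_eq_zero_of_natDegree_lt, smul_zero,
      zero_add]
    have := natDegree_shiftPoly_le (R := R) m (n - 1)
    omega

/-- The polynomials in a column have pairwise distinct degrees. -/
theorem linearIndependent_shiftPoly [IsDomain R] (k : ℕ) :
    LinearIndependent R fun n => shiftPoly R n k := by
  rw [linearIndependent_iff]
  intro a ha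
  by_contra hne
  set N := a.support.max' (Finsupp.support_nonempty_iff.2 hne) with hN
  have hNmem : N ∈ a.support := Finset.max'_mem _ _
  -- In degree `N + k`, with `N` the largest index that occurs, only the term of index `N`
  -- contributes, and its leading coefficient is `(-1)^k`.
  have h := congrArg (fun p => Polynomial.coeff p (N + k)) ha
  simp only [Finsupp.linearCombination_apply, Finsupp.sum, Polynomial.finsetSum_coeff,
    Polynomial.coeff_smul, Polynomial.coeff_zero, smul_eq_mul] at h
  rw [Finset.sum_eq_single_of_mem N hNmem, coeff_shiftPoly] at h
  · exact Finsupp.mem_support_iff.1 hNmem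
      ((mul_eq_zero.1 h).resolve_right (pow_ne_zero _ (neg_ne_zero.2 one_ne_zero)))
  · intro j hj hjN
    rw [Polynomial.coeff_eq_zero_of_natDegree_lt, mul_zero]
    have h1 := natDegree_shiftPoly_le (R := R) j k
    have h2 : j ≤ N := Finset.le_max' _ _ hj
    omega

end ShiftPoly

/-! ### Matrix elements of `D(z)` via Taylor series -/

/-- The entire function whose value at real `s` is `⟨m|D(su)|n⟩`, for `|u| = 1`. -/
def shiftEntry (u : ℂ) (m n : ℕ) (s : ℂ) : ℂ :=
  u ^ m * conj u ^ n * ((Real.sqrt m.factorial : ℂ)⁻¹ * (Real.sqrt n.factorial : ℂ)⁻¹) *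
    (Complex.exp (-(s ^ 2 / 2)) * (shiftPoly ℂ m n).eval s)

theorem sqrt_succ_mul_inv_sqrt_factorial (n : ℕ) :
    ((Real.sqrt (n + 1) : ℝ) : ℂ) * (Real.sqrt (n + 1).factorial : ℂ)⁻¹ =
      (Real.sqrt n.factorial : ℂ)⁻¹ := by
  have h1 : (Real.sqrt n.factorial : ℂ) ≠ 0 := by
    exact_mod_cast (Real.sqrt_pos.2 (by exact_mod_cast n.factorial_pos)).ne'
  have h2 : ((Real.sqrt (n + 1) : ℝ) : ℂ) ≠ 0 := by
    exact_mod_cast (Real.sqrt_pos.2 (by positivity)).ne'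
  have h3 : Real.sqrt (n + 1).factorial = Real.sqrt (n + 1) * Real.sqrt n.factorial := by
    rw [← Real.sqrt_mul (by positivity), Nat.factorial_succ]
    push_cast
    rfl
  rw [h3]
  push_cast
  field_simp

theorem hasDerivAt_exp_neg_sq_half_mul_shiftPoly (m n : ℕ) (s : ℂ) :
    HasDerivAt (fun s : ℂ => Complex.exp (-(s ^ 2 / 2)) * (shiftPoly ℂ m n).eval s)
      (Complex.exp (-(s ^ 2 / 2)) * (shiftPoly ℂ m (n + 1)).eval s -
        n * (Complex.exp (-(s ^ 2 / 2)) * (shiftPoly ℂ m (n - 1)).eval s)) s := by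
  have h1 : HasDerivAt (fun s : ℂ => -(s ^ 2 / 2)) (-s) s := by
    have := ((hasDerivAt_pow 2 s).div_const 2).neg
    convert! this using 1
    simp
  refine (h1.cexp.mul ((shiftPoly ℂ m n).hasDerivAt s)).congr_deriv ?_
  have h2 := congrArg (Polynomial.eval s) (shiftPoly_recurrence (R := ℂ) m n).1
  rw [derivative_shiftPoly]
  simp only [Polynomial.eval_sub, Polynomial.eval_mul, Polynomial.eval_natCast,
    Polynomial.eval_add, Polynomial.eval_X] at h2 ⊢
  linear_combination Complex.exp (-(s ^ 2 / 2)) * h2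

/-- This is `d/ds D(su) = D(su)(u a* - ū a)` read off in column `n`. The extra factor `ū` in column
`n + 1` is compensated by `u ū = 1`. -/
theorem hasDerivAt_shiftEntry {u : ℂ} (hu : u * conj u = 1) (m n : ℕ) (s : ℂ) :
    HasDerivAt (shiftEntry u m n)
      (u * (Real.sqrt (n + 1) : ℝ) * shiftEntry u m (n + 1) s -
        conj u * (Real.sqrt n : ℝ) * shiftEntry u m (n - 1) s) s := by
  refine ((hasDerivAt_exp_neg_sq_half_mul_shiftPoly m n s).const_mul _).congr_deriv ?_
  rw [mul_sub]
  congr 1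
  · rw [shiftEntry, ← sqrt_succ_mul_inv_sqrt_factorial n, pow_succ (conj u)]
    generalize Complex.exp (-(s ^ 2 / 2)) = e
    linear_combination (-1 : ℂ) * (u ^ m * conj u ^ n * ((Real.sqrt m.factorial : ℂ)⁻¹ *
      (Real.sqrt (n + 1) * (Real.sqrt (n + 1).factorial : ℂ)⁻¹)) *
      (e * (shiftPoly ℂ m (n + 1)).eval s)) * hu
  · rcases n with _ | n
    · simp
    · have h : (((n + 1 : ℕ) : ℝ) : ℂ) = (Real.sqrt (n + 1) : ℝ) * (Real.sqrt (n + 1) : ℝ) := by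
        rw [← Complex.ofReal_mul, Real.mul_self_sqrt (by positivity)]
        push_cast
        rfl
      rw [shiftEntry, Nat.add_sub_cancel, ← sqrt_succ_mul_inv_sqrt_factorial n, pow_succ (conj u)]
      push_cast at h ⊢
      rw [h]
      ring

theorem shiftEntry_zero {u : ℂ} (hu : u * conj u = 1) (m n : ℕ) :
    shiftEntry u m n 0 = if m = n then 1 else 0 := by
  rw [shiftEntry, eval_zero_shiftPoly]
  split_ifs with h
  · subst h
    have h1 : (Real.sqrt m.factorial : ℂ) ≠ 0 := by
      exact_mod_cast (Real.sqrt_pos.2 (by exact_mod_cast m.factorial_pos)).ne'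
    have h2 : (m.factorial : ℂ) = (Real.sqrt m.factorial : ℂ) * (Real.sqrt m.factorial : ℂ) := by
      rw [← Complex.ofReal_mul, Real.mul_self_sqrt (by positivity)]
      simp
    rw [← mul_pow, hu, one_pow, h2]
    simp
    field_simp
  · simp

theorem hasDerivAt_linearCombination_shiftEntry {u : ℂ} (hu : u * conj u = 1) (m : ℕ)
    (f : ℕ →₀ ℂ) (s : ℂ) :
    HasDerivAt (Finsupp.linearCombination ℂ (shiftEntry u m) f)
      (Finsupp.linearCombination ℂ (shiftEntry u m) (shiftGen u f) s) s := by
  induction f using Finsupp.induction_linear with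
  | zero => simp
  | add f g hf hg =>
    simp only [map_add, Pi.add_apply]
    exact hf.add hg
  | single n c =>
    have h : shiftGen u (Finsupp.single n c) = c • shiftGen u (Finsupp.single n 1) := by
      rw [← map_smul, Finsupp.smul_single, smul_eq_mul, mul_one]
    rw [h, shiftGen_single]
    simp only [map_smul, map_sub, Finsupp.linearCombination_single, one_smul, Pi.smul_apply,
      Pi.sub_apply, smul_eq_mul]
    exact (hasDerivAt_shiftEntry hu m n s).const_smul c

/-- Differentiating the entries corresponds to letting the generator act on the coefficient vector.
Evaluated at `0`, where the entries form the identity matrix, this produces the coefficients of the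
exponential series. -/
theorem iteratedDeriv_linearCombination_shiftEntry {u : ℂ} (hu : u * conj u = 1) (m k : ℕ)
    (f : ℕ →₀ ℂ) :
    iteratedDeriv k (Finsupp.linearCombination ℂ (shiftEntry u m) f) =
      Finsupp.linearCombination ℂ (shiftEntry u m) ((shiftGen u ^ k) f) := by
  induction k generalizing f with
  | zero => simp
  | succ k ih =>
    rw [iteratedDeriv_succ', pow_succ, Module.End.mul_apply, ← ih]
    congr 1
    exact funext fun s => (hasDerivAt_linearCombination_shiftEntry hu m f s).deriv

theorem linearCombination_shiftEntry_zero (b : HilbertBasis ℕ ℂ H) {u : ℂ} (hu : u * conj u = 1)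
    (m : ℕ) (f : ℕ →₀ ℂ) :
    Finsupp.linearCombination ℂ (shiftEntry u m) f 0 = inner ℂ (b m) (numberVec b f) := by
  induction f using Finsupp.induction_linear with
  | zero => simp
  | add f g hf hg => simp only [map_add, Pi.add_apply, hf, hg, inner_add_right]
  | single n c =>
    simp only [numberVec, Finsupp.linearCombination_single, Pi.smul_apply, shiftEntry_zero hu,
      inner_smul_right, orthonormal_iff_ite.1 b.orthonormal m n, smul_eq_mul]

theorem shiftGen_ofReal_mul (s : ℝ) (u : ℂ) : shiftGen (s * u) = (s : ℂ) • shiftGen u := by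
  rw [shiftGen, shiftGen, map_mul, Complex.conj_ofReal]
  module

theorem numberVec_single (b : HilbertBasis ℕ ℂ H) (n : ℕ) :
    numberVec b (Finsupp.single n 1) = b n := by
  rw [numberVec, Finsupp.linearCombination_single, one_smul]

/-- The exponential series of `D(su)|n⟩`, paired with `|m⟩`, is term by term the Taylor series at
`0` of the entire function `shiftEntry u m n`. Both sums therefore agree at `s`. -/
theorem inner_shift_eq_shiftEntry (b : HilbertBasis ℕ ℂ H) {u : ℂ} (hu : u * conj u = 1) (s : ℝ)
    (m n : ℕ) : inner ℂ (b m) (shift b (s * u) (b n)) = shiftEntry u m n s := by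
  have h1 := (hasSum_shift b (s * u) (Finsupp.single n 1)).mapL (innerSL ℂ (b m))
  have hd : Differentiable ℂ (Finsupp.linearCombination ℂ (shiftEntry u m) (Finsupp.single n 1)) :=
    fun s => (hasDerivAt_linearCombination_shiftEntry hu m _ s).differentiableAt
  have h2 := Complex.hasSum_taylorSeries_of_entire hd 0 (s : ℂ)
  rw [numberVec_single] at h1
  rw [Finsupp.linearCombination_single, one_smul] at h2
  refine h1.unique (h2.congr_fun fun k => ?_)
  have e : Finsupp.linearCombination ℂ (shiftEntry u m) (Finsupp.single n 1) = shiftEntry u m n := by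
    rw [Finsupp.linearCombination_single, one_smul]
  rw [sub_zero, ← e, iteratedDeriv_linearCombination_shiftEntry hu,
    linearCombination_shiftEntry_zero b hu,    shiftGen_ofReal_mul, smul_pow, LinearMap.smul_apply, map_smul, map_smul, map_smul,
    innerSL_apply_apply]

/-- The real number `⟨m|D(r)|n⟩`. -/
def shiftAmp (m n : ℕ) (r : ℝ) : ℝ :=
  (Real.sqrt m.factorial)⁻¹ * (Real.sqrt n.factorial)⁻¹ *
    (Real.exp (-(r ^ 2 / 2)) * (shiftPoly ℝ m n).eval r)

theorem inner_shift (b : HilbertBasis ℕ ℂ H) {u : ℂ} (hu : u * conj u = 1) (r : ℝ) (m n : ℕ) :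
    inner ℂ (b m) (shift b (r * u) (b n)) = u ^ m * conj u ^ n * shiftAmp m n r := by
  rw [inner_shift_eq_shiftEntry b hu, shiftEntry, shiftAmp, ← map_shiftPoly Complex.ofRealHom,
    ← Complex.ofRealHom_eq_coe r, Polynomial.eval_map_apply]
  push_cast
  simp
  ring

/-! ### Gaussian integrals and the radial normalization -/

theorem integrable_exp_neg_sq_mul_polynomial (p : ℝ[X]) :
    Integrable fun r : ℝ => Real.exp (-r ^ 2) * p.eval r := by
  induction p using Polynomial.induction_on' with
  | add p q hp hq =>
    exact (hp.add hq).congr (Eventually.of_forall fun r => by simp [mul_add])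
  | monomial n a =>
    have h := (integrable_rpow_mul_exp_neg_mul_sq (b := 1) one_pos (s := n)
      (by have : (0 : ℝ) ≤ n := by positivity
          linarith)).const_mul a
    refine h.congr (Eventually.of_forall fun r => ?_)
    simp only [Real.rpow_natCast, Polynomial.eval_monomial]
    ring_nf

/-- The function `√(m! n!) ⟨m|D(r)|n⟩` of the real number `r`. -/
def shiftGauss (m n : ℕ) (r : ℝ) : ℝ := Real.exp (-(r ^ 2 / 2)) * (shiftPoly ℝ m n).eval r

theorem shiftGauss_mul (m n m' n' : ℕ) (r : ℝ) : shiftGauss m n r * shiftGauss m' n' r =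
    Real.exp (-r ^ 2) * (shiftPoly ℝ m n * shiftPoly ℝ m' n').eval r := by
  rw [shiftGauss, shiftGauss, Polynomial.eval_mul, show -r ^ 2 = -(r ^ 2 / 2) + -(r ^ 2 / 2) by ring,
    Real.exp_add]
  ring

theorem integrable_shiftGauss_mul (m n m' n' : ℕ) :
    Integrable fun r : ℝ => r * (shiftGauss m n r * shiftGauss m' n' r) := by
  refine (integrable_exp_neg_sq_mul_polynomial
    (Polynomial.X * (shiftPoly ℝ m n * shiftPoly ℝ m' n'))).congr (Eventually.of_forall fun r => ?_)
  simp only [shiftGauss_mul, Polynomial.eval_mul, Polynomial.eval_X]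
  ring

theorem hasDerivAt_shiftGauss (m n : ℕ) (r : ℝ) :
    HasDerivAt (shiftGauss m n) (shiftGauss m (n + 1) r - n * shiftGauss m (n - 1) r) r := by
  have h1 : HasDerivAt (fun s : ℝ => -(s ^ 2 / 2)) (-r) r := by
    have := ((hasDerivAt_pow 2 r).div_const 2).neg
    convert! this using 1
    simp
  refine (h1.exp.mul ((shiftPoly ℝ m n).hasDerivAt r)).congr_deriv ?_
  have h2 := congrArg (Polynomial.eval r) (shiftPoly_recurrence (R := ℝ) m n).1
  rw [derivative_shiftPoly, shiftGauss, shiftGauss]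
  simp only [Polynomial.eval_sub, Polynomial.eval_mul, Polynomial.eval_natCast,
    Polynomial.eval_add, Polynomial.eval_X] at h2 ⊢
  linear_combination Real.exp (-(r ^ 2 / 2)) * h2

theorem shiftGauss_recurrence (m n : ℕ) (r : ℝ) :
    r * shiftGauss m (n + 1) r + r ^ 2 * shiftGauss m n r + r * (n * shiftGauss m (n - 1) r) =
      (m - n) * shiftGauss m n r := by
  have h1 := congrArg (Polynomial.eval r) (shiftPoly_recurrence (R := ℝ) m n).1
  have h2 := congrArg (Polynomial.eval r) (shiftPoly_recurrence (R := ℝ) m n).2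
  simp only [Polynomial.eval_sub, Polynomial.eval_mul, Polynomial.eval_natCast,
    Polynomial.eval_add, Polynomial.eval_X] at h1 h2
  simp only [shiftGauss]
  linear_combination Real.exp (-(r ^ 2 / 2)) * h2 - r * Real.exp (-(r ^ 2 / 2)) * h1

/-- The expression is chosen so that its derivative is the difference of the integrands for `n + 1`
and for `n`, the latter weighted by `n + 1`. Integrating it gives a recursion in `n` for the squared
norms. -/
theorem hasDerivAt_mul_shiftGauss_mul (m n : ℕ) (r : ℝ) :
    HasDerivAt (fun r : ℝ => r * (shiftGauss m n r * shiftGauss m (n + 1) r))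
      (2 * (r * (shiftGauss m (n + 1) r * shiftGauss m (n + 1) r)) -
        (n + 1) * (2 * (r * (shiftGauss m n r * shiftGauss m n r)))) r := by
  refine ((hasDerivAt_id r).mul ((hasDerivAt_shiftGauss m n r).mul
    (hasDerivAt_shiftGauss m (n + 1) r))).congr_deriv ?_
  have h1 := shiftGauss_recurrence m n r
  have h2 := shiftGauss_recurrence m (n + 1) r
  simp only [Nat.add_sub_cancel, id, Pi.mul_apply, Nat.cast_add, Nat.cast_one] at h1 h2 ⊢
  linear_combination (shiftGauss m n r) * h2 - shiftGauss m (n + 1) r * h1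

theorem integral_shiftGauss_sq (m n : ℕ) :
    ∫ r in Set.Ioi (0 : ℝ), 2 * (r * (shiftGauss m n r * shiftGauss m n r)) =
      m.factorial * n.factorial := by
  induction n with
  | zero =>
    have h := integral_rpow_mul_exp_neg_mul_rpow (p := 2) (q := 2 * m + 1) (b := 1) (by norm_num)
      (by have : (0 : ℝ) ≤ m := by positivity
          linarith) one_pos
    rw [show ((2 * (m : ℝ) + 1 + 1) / 2) = m + 1 by ring, Real.Gamma_nat_eq_factorial,
      Real.one_rpow] at h
    rw [integral_const_mul]
    have e : ∫ r in Set.Ioi (0 : ℝ), r * (shiftGauss m 0 r * shiftGauss m 0 r) =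
        ∫ x in Set.Ioi (0 : ℝ), x ^ (2 * (m : ℝ) + 1) * Real.exp (-1 * x ^ (2 : ℝ)) := by
      refine setIntegral_congr_fun measurableSet_Ioi fun r _ => ?_
      have e1 : r ^ (2 * (m : ℝ) + 1) = r ^ (2 * m + 1) := by
        rw [← Real.rpow_natCast]
        push_cast
        rfl
      simp only [shiftGauss_mul, e1, Real.rpow_two, shiftPoly_right_zero, Polynomial.eval_mul,
        Polynomial.eval_pow, Polynomial.eval_X]
      ring_nf
    rw [e, h]
    simp
  | succ n ih =>
    have hi := fun n => ((integrable_shiftGauss_mul m n m n).const_mul 2).integrableOn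
      (s := Set.Ioi (0 : ℝ))
    have hd := (hi (n + 1)).sub ((hi n).const_mul (n + 1))
    -- The boundary term at infinity vanishes because the function and its derivative are both
    -- integrable; the one at `0` vanishes through the factor `r`.
    have ht := tendsto_zero_of_hasDerivAt_of_integrableOn_Ioi (a := 0)
      (fun r _ => hasDerivAt_mul_shiftGauss_mul m n r) hd
      (integrable_shiftGauss_mul m n m (n + 1)).integrableOn
    have h := integral_Ioi_of_hasDerivAt_of_tendsto' (a := 0)
      (fun r _ => hasDerivAt_mul_shiftGauss_mul m n r) hd ht
    rw [integral_sub (hi (n + 1)) ((hi n).const_mul (n + 1)), integral_const_mul ((n : ℝ) + 1), ih] at h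
    rw [Nat.factorial_succ]
    push_cast
    linear_combination h

theorem shiftAmp_eq (m n : ℕ) (r : ℝ) : shiftAmp m n r =
    (Real.sqrt m.factorial)⁻¹ * (Real.sqrt n.factorial)⁻¹ * shiftGauss m n r := rfl

theorem integrable_shiftAmp_mul (m n m' n' : ℕ) :
    Integrable fun r : ℝ => r * (shiftAmp m n r * shiftAmp m' n' r) := by
  refine ((integrable_shiftGauss_mul m n m' n').const_mul
    ((Real.sqrt m.factorial)⁻¹ * (Real.sqrt n.factorial)⁻¹ *
      ((Real.sqrt m'.factorial)⁻¹ * (Real.sqrt n'.factorial)⁻¹))).congr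
        (Eventually.of_forall fun r => ?_)
  simp only [shiftAmp_eq]
  ring

theorem integral_shiftAmp_sq (m n : ℕ) :
    ∫ r in Set.Ioi (0 : ℝ), 2 * (r * (shiftAmp m n r * shiftAmp m n r)) = 1 := by
  have hm : (0 : ℝ) < m.factorial := by exact_mod_cast m.factorial_pos
  have hn : (0 : ℝ) < n.factorial := by exact_mod_cast n.factorial_pos
  have e : (fun r : ℝ => 2 * (r * (shiftAmp m n r * shiftAmp m n r))) = fun r =>
      ((m.factorial : ℝ) * n.factorial)⁻¹ * (2 * (r * (shiftGauss m n r * shiftGauss m n r))) := by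
    funext r
    have h1 := Real.mul_self_sqrt hm.le
    have h2 := Real.mul_self_sqrt hn.le
    have h1' := Real.sqrt_pos.2 hm
    have h2' := Real.sqrt_pos.2 hn
    rw [shiftAmp_eq, ← h1, ← h2, Real.sqrt_mul_self (Real.sqrt_nonneg _),
      Real.sqrt_mul_self (Real.sqrt_nonneg _)]
    field_simp
  rw [e, integral_const_mul, integral_shiftGauss_sq, inv_mul_cancel₀ (mul_pos hm hn).ne']

/-! ### Angular integrals and rotation -/

theorem measurableSet_argSet (X : BorelSet) : MeasurableSet (argSet X) :=
  measurableSet_Ico.inter (Circle.exp.continuous.measurable X.2)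

/-- The integral of `e^{i(m-n)θ}` over `arg X`. -/
def phaseIntegral (X : BorelSet) (m n : ℕ) : ℂ :=
  ∫ θ in argSet X, Complex.exp (Complex.I * ((m : ℂ) - (n : ℂ)) * (θ : ℂ))

theorem argSet_univ : argSet ⟨Set.univ, MeasurableSet.univ⟩ = Set.Ico 0 (2 * Real.pi) := by
  exact Set.ext fun θ => by simp [argSet]

theorem phaseIntegral_univ (m n : ℕ) :
    phaseIntegral ⟨Set.univ, MeasurableSet.univ⟩ m n = if m = n then 2 * (Real.pi : ℂ) else 0 := by
  rw [phaseIntegral, argSet_univ, integral_Ico_eq_integral_Ioc,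
    ← intervalIntegral.integral_of_le (by positivity)]
  split_ifs with h
  · subst h
    simp
  · have hc : Complex.I * ((m : ℂ) - (n : ℂ)) ≠ 0 :=
      mul_ne_zero Complex.I_ne_zero (sub_ne_zero.2 (by exact_mod_cast h))
    rw [integral_exp_mul_complex hc]
    have e : Complex.exp (Complex.I * ((m : ℂ) - (n : ℂ)) * ((2 * Real.pi : ℝ) : ℂ)) = 1 := by
      rw [Complex.exp_eq_one_iff]
      exact ⟨(m : ℤ) - n, by push_cast; ring⟩
    rw [e]
    simp

theorem circle_exp_pow_mul (t : Circle) (m n : ℕ) (α : ℝ) (ht : Circle.exp α = t) :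
    (t : ℂ) ^ m * conj (t : ℂ) ^ n = Complex.exp (Complex.I * ((m : ℂ) - (n : ℂ)) * (α : ℂ)) := by
  rw [← ht, Circle.coe_exp, ← Complex.exp_conj, ← Complex.exp_nat_mul, ← Complex.exp_nat_mul,
    ← Complex.exp_add]
  congr 1
  simp
  ring

theorem phaseIntegral_eq_interval (X : BorelSet) (m n : ℕ) : phaseIntegral X m n =
    ∫ θ in (0 : ℝ)..(0 + 2 * Real.pi), (Circle.exp ⁻¹' (X : Set Circle)).indicator
      (fun θ : ℝ => Complex.exp (Complex.I * ((m : ℂ) - (n : ℂ)) * (θ : ℂ))) θ := by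
  have hm : MeasurableSet (Circle.exp ⁻¹' (X : Set Circle)) := Circle.exp.continuous.measurable X.2
  rw [intervalIntegral.integral_of_le (by linarith [Real.pi_pos]), ← integral_Ico_eq_integral_Ioc,
    zero_add, integral_indicator hm, Measure.restrict_restrict hm, phaseIntegral, Set.inter_comm]
  rfl

/-- Rotation by `e^{iα}` translates the angle by `α`. The integrand is `2π`-periodic since `m - n`
is an integer, so the shifted period can be moved back to `[0, 2π)`. -/
theorem phaseIntegral_rotate (t : Circle) (X : BorelSet) (m n : ℕ) :
    phaseIntegral (rotate t X) m n = (t : ℂ) ^ m * conj (t : ℂ) ^ n * phaseIntegral X m n := by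
  obtain ⟨α, hα⟩ : ∃ α, Circle.exp α = t := ⟨Complex.arg t, Circle.exp_arg t⟩
  rw [phaseIntegral_eq_interval, phaseIntegral_eq_interval, circle_exp_pow_mul t m n α hα]
  set G : ℝ → ℂ := (Circle.exp ⁻¹' (X : Set Circle)).indicator
    (fun θ : ℝ => Complex.exp (Complex.I * ((m : ℂ) - (n : ℂ)) * (θ : ℂ))) with hG
  have hper : Function.Periodic G (2 * Real.pi) := by
    intro θ
    have e : Complex.exp (Complex.I * ((m : ℂ) - (n : ℂ)) * ((θ + 2 * Real.pi : ℝ) : ℂ)) =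
        Complex.exp (Complex.I * ((m : ℂ) - (n : ℂ)) * (θ : ℂ)) := by
      rw [Complex.exp_eq_exp_iff_exists_int]
      exact ⟨(m : ℤ) - n, by push_cast; ring⟩
    have h1 : θ + 2 * Real.pi ∈ Circle.exp ⁻¹' (X : Set Circle) ↔
        θ ∈ Circle.exp ⁻¹' (X : Set Circle) := by
      rw [Set.mem_preimage, Circle.exp_add_two_pi, Set.mem_preimage]
    by_cases h : θ ∈ Circle.exp ⁻¹' (X : Set Circle)
    · rw [hG, Set.indicator_of_mem h, Set.indicator_of_mem (h1.2 h), e]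
    · rw [hG, Set.indicator_of_notMem h, Set.indicator_of_notMem (mt h1.1 h)]
  have e : ∀ θ : ℝ, (Circle.exp ⁻¹' (rotate t X : Set Circle)).indicator
      (fun θ : ℝ => Complex.exp (Complex.I * ((m : ℂ) - (n : ℂ)) * (θ : ℂ))) θ =
        Complex.exp (Complex.I * ((m : ℂ) - (n : ℂ)) * (α : ℂ)) * G (θ - α) := by
    intro θ
    have h1 : θ ∈ Circle.exp ⁻¹' (rotate t X : Set Circle) ↔
        θ - α ∈ Circle.exp ⁻¹' (X : Set Circle) := by
      rw [Set.mem_preimage, Set.mem_preimage, rotate, Set.mem_smul_set_iff_inv_smul_mem, ← hα, Circle.exp_sub, smul_eq_mul, mul_comm,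
        div_eq_mul_inv]
    by_cases h : θ - α ∈ Circle.exp ⁻¹' (X : Set Circle)
    · rw [hG, Set.indicator_of_mem h, Set.indicator_of_mem (h1.2 h), ← Complex.exp_add]
      congr 1
      push_cast
      ring
    · rw [hG, Set.indicator_of_notMem h, Set.indicator_of_notMem (mt h1.1 h), mul_zero]
  simp_rw [e]
  rw [intervalIntegral.integral_const_mul, intervalIntegral.integral_comp_sub_right G α,
    show 0 + 2 * Real.pi - α = (0 - α) + 2 * Real.pi by ring, hper.intervalIntegral_add_eq (0 - α) 0]

/-! ### Phase observables from sequences of unit vectors -/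

/-- The isometry carrying an orthonormal basis to an orthonormal sequence. -/
def orthonormalIsometry (b : HilbertBasis ℕ ℂ H) {E : Type*} [NormedAddCommGroup E]
    [InnerProductSpace ℂ E] [CompleteSpace E] {v : ℕ → E} (hv : Orthonormal ℂ v) : H →ₗᵢ[ℂ] E :=
  hv.orthogonalFamily.linearIsometry.comp b.repr.toLinearIsometry

theorem orthonormalIsometry_apply_basis (b : HilbertBasis ℕ ℂ H) {E : Type*}
    [NormedAddCommGroup E] [InnerProductSpace ℂ E] [CompleteSpace E] {v : ℕ → E}
    (hv : Orthonormal ℂ v) (n : ℕ) : orthonormalIsometry b hv (b n) = v n := by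
  classical
  simp [orthonormalIsometry, HilbertBasis.repr_self]

section Wave

variable {K : Type*} [NormedAddCommGroup K] [InnerProductSpace ℂ K] [CompleteSpace K]

/-- Lebesgue measure on `[0, 2π)`. -/
def angleMeasure : Measure ℝ := volume.restrict (Set.Ico 0 (2 * Real.pi))

instance : IsFiniteMeasure angleMeasure :=
  ⟨by rw [angleMeasure, Measure.restrict_apply_univ, Real.volume_Ico]; exact ENNReal.ofReal_lt_top⟩

theorem angleMeasure_restrict (X : BorelSet) :
    angleMeasure.restrict (Circle.exp ⁻¹' (X : Set Circle)) = volume.restrict (argSet X) := by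
  rw [angleMeasure, Measure.restrict_restrict (Circle.exp.continuous.measurable X.2),
    Set.inter_comm]
  rfl

/-- The function `θ ↦ (2π)^{-1/2} e^{-inθ} η_n`. -/
def waveFun (η : ℕ → K) (n : ℕ) (θ : ℝ) : K :=
  (((Real.sqrt (2 * Real.pi))⁻¹ : ℝ) * Complex.exp (-(Complex.I * n * θ)) : ℂ) • η n

theorem memLp_waveFun (η : ℕ → K) (n : ℕ) : MemLp (waveFun η n) 2 angleMeasure := by
  refine MemLp.of_bound (Continuous.aestronglyMeasurable ?_) ((Real.sqrt (2 * Real.pi))⁻¹ * ‖η n‖)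
    (Eventually.of_forall fun θ => ?_)
  · unfold waveFun
    fun_prop
  · rw [waveFun, norm_smul, norm_mul, Complex.norm_exp, Complex.norm_real, Real.norm_of_nonneg (by positivity)]
    simp

/-- `waveFun` as an element of the space of square integrable functions. -/
def wave (η : ℕ → K) (n : ℕ) : Lp K 2 angleMeasure := (memLp_waveFun η n).toLp

theorem inner_waveFun (η : ℕ → K) (m n : ℕ) (θ : ℝ) :
    inner ℂ (waveFun η m θ) (waveFun η n θ) = inner ℂ (η m) (η n) *
      (Complex.exp (Complex.I * ((m : ℂ) - (n : ℂ)) * (θ : ℂ)) / (2 * (Real.pi : ℂ))) := by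
  have h : (((Real.sqrt (2 * Real.pi))⁻¹ : ℝ) : ℂ) * ((Real.sqrt (2 * Real.pi))⁻¹ : ℝ) =
      (2 * (Real.pi : ℂ))⁻¹ := by
    rw [← Complex.ofReal_mul, ← mul_inv, Real.mul_self_sqrt (by positivity)]
    push_cast
    rfl
  have h2 : Complex.exp (Complex.I * ((m : ℂ) - (n : ℂ)) * (θ : ℂ)) =
      conj (Complex.exp (-(Complex.I * m * θ))) * Complex.exp (-(Complex.I * n * θ)) := by
    rw [← Complex.exp_conj, ← Complex.exp_add]
    congr 1
    simp
    ring
  rw [waveFun, waveFun, inner_smul_left, inner_smul_right, map_mul, Complex.conj_ofReal,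
    div_eq_mul_inv, h2, ← h]
  ring

theorem setIntegral_inner_wave (η : ℕ → K) (X : BorelSet) (m n : ℕ) :
    ∫ θ in argSet X, inner ℂ (wave η m θ) (wave η n θ) =
      inner ℂ (η m) (η n) * (phaseIntegral X m n / (2 * (Real.pi : ℂ))) := by
  have h : ∀ n, ⇑(wave η n) =ᵐ[volume.restrict (argSet X)] waveFun η n := fun n => by
    rw [← angleMeasure_restrict]
    exact ae_restrict_of_ae (memLp_waveFun η n).coeFn_toLp
  rw [phaseIntegral, ← integral_div, ← integral_const_mul]
  refine integral_congr_ae ?_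
  filter_upwards [h m, h n] with θ h1 h2
  rw [h1, h2, inner_waveFun]

/-- Orthogonality comes from the Fourier modes `e^{-inθ}` alone, so the `η_n` need only have norm
one and may be arbitrarily correlated. -/
theorem orthonormal_wave {η : ℕ → K} (hη : ∀ n, ‖η n‖ = 1) : Orthonormal ℂ (wave η) := by
  rw [orthonormal_iff_ite]
  intro m n
  have h := setIntegral_inner_wave η ⟨Set.univ, MeasurableSet.univ⟩ m n
  rw [argSet_univ, phaseIntegral_univ] at h
  refine (L2.inner_def (𝕜 := ℂ) _ _).trans (h.trans ?_)
  have hpi : (Real.pi : ℂ) ≠ 0 := by exact_mod_cast Real.pi_pos.ne'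
  split_ifs with hmn
  · subst hmn
    rw [inner_self_eq_norm_sq_to_K, hη]
    field_simp
    simp
  · simp

/-- The phase observable `X ↦ V* χ_X V`, where the isometry `V` maps `|n⟩` to the function
`θ ↦ (2π)^{-1/2} e^{-inθ} η_n`. -/
def waveObservable (b : HilbertBasis ℕ ℂ H) {η : ℕ → K} (hη : ∀ n, ‖η n‖ = 1) :
    OperatorSetFunction H := fun X =>
  ContinuousLinearMap.adjoint (LpToLpRestrictCLM ℝ K ℂ angleMeasure 2
      (Circle.exp ⁻¹' (X : Set Circle)) ∘L
        (orthonormalIsometry b (orthonormal_wave hη)).toContinuousLinearMap) ∘L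
    (LpToLpRestrictCLM ℝ K ℂ angleMeasure 2 (Circle.exp ⁻¹' (X : Set Circle)) ∘L
      (orthonormalIsometry b (orthonormal_wave hη)).toContinuousLinearMap)

variable (b : HilbertBasis ℕ ℂ H) {η : ℕ → K} (hη : ∀ n, ‖η n‖ = 1)

theorem inner_waveObservable (X : BorelSet) (φ ψ : H) :
    inner ℂ φ (waveObservable b hη X ψ) =
      ∫ θ in Circle.exp ⁻¹' (X : Set Circle), inner ℂ
        (orthonormalIsometry b (orthonormal_wave hη) φ θ)
        (orthonormalIsometry b (orthonormal_wave hη) ψ θ) ∂angleMeasure := by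
  rw [waveObservable, ContinuousLinearMap.comp_apply, ContinuousLinearMap.adjoint_inner_right,
    L2.inner_def]
  refine integral_congr_ae ?_
  filter_upwards [LpToLpRestrictCLM_coeFn ℂ (Circle.exp ⁻¹' (X : Set Circle))
      (orthonormalIsometry b (orthonormal_wave hη) φ),
    LpToLpRestrictCLM_coeFn ℂ (Circle.exp ⁻¹' (X : Set Circle))
      (orthonormalIsometry b (orthonormal_wave hη) ψ)] with θ h1 h2
  exact congrArg₂ _ h1 h2

theorem inner_basis_waveObservable (X : BorelSet) (m n : ℕ) :
    inner ℂ (b m) (waveObservable b hη X (b n)) =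
      inner ℂ (η m) (η n) * (phaseIntegral X m n / (2 * (Real.pi : ℂ))) := by
  rw [inner_waveObservable, angleMeasure_restrict, orthonormalIsometry_apply_basis,
    orthonormalIsometry_apply_basis, setIntegral_inner_wave]

theorem isObservable_waveObservable : IsObservable (waveObservable b hη) := by
  have hnn : ∀ X, 0 ≤ waveObservable b hη X := fun X =>
    (ContinuousLinearMap.nonneg_iff_isPositive _).2
      (ContinuousLinearMap.isPositive_adjoint_comp_self _)
  have huniv : waveObservable b hη ⟨Set.univ, MeasurableSet.univ⟩ = 1 := by
    ext ψ
    refine ext_inner_left ℂ fun φ => ?_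
    rw [inner_waveObservable]
    simp only [Set.preimage_univ, Measure.restrict_univ]
    rw [← L2.inner_def, LinearIsometry.inner_map_map]
    rfl
  refine ⟨hnn, fun X => ?_, huniv, fun X hX φ ψ => ?_⟩
  -- The upper bound follows from additivity: the effect of the complement is nonnegative and the
  -- two add up to `1`.
  · have e : waveObservable b hη X + waveObservable b hη ⟨(X : Set Circle)ᶜ, X.2.compl⟩ = 1 := by
      rw [← huniv]
      ext ψ
      refine ext_inner_left ℂ fun φ => ?_
      rw [_root_.add_apply, inner_add_right, inner_waveObservable,
        inner_waveObservable, inner_waveObservable]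
      simp only [Set.preimage_univ, Measure.restrict_univ, Set.preimage_compl]
      exact integral_add_compl (Circle.exp.continuous.measurable X.2) (L2.integrable_inner _ _)
    rw [← e]
    exact le_add_of_nonneg_right (hnn _)
  · simp only [inner_waveObservable, Set.preimage_iUnion]
    exact hasSum_integral_iUnion (fun i => Circle.exp.continuous.measurable (X i).2)
      (fun i j hij => (hX hij).preimage _) (L2.integrable_inner _ _).integrableOn

theorem clm_ext_inner_basis {A B : H →L[ℂ] H}
    (h : ∀ m n, inner ℂ (b m) (A (b n)) = inner ℂ (b m) (B (b n))) : A = B := by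
  refine ContinuousLinearMap.ext_on (s := Set.range b) ?_ ?_
  · rw [Submodule.dense_iff_topologicalClosure_eq_top]
    exact b.dense_span
  · rintro _ ⟨n, rfl⟩
    refine b.repr.injective (lp.ext (funext fun m => ?_))
    rw [b.repr_apply_apply, b.repr_apply_apply, h]

theorem adjoint_numberRep_apply_basis (t : Circle) (n : ℕ) :
    ContinuousLinearMap.adjoint (numberRep b t : H →L[ℂ] H) (b n) = conj (t : ℂ) ^ n • b n := by
  refine b.repr.injective (lp.ext (funext fun m => ?_))
  have h : (numberRep b t : H →L[ℂ] H) (b m) = (t : ℂ) ^ m • b m := numberRep_apply_basis b t m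
  rw [b.repr_apply_apply, b.repr_apply_apply, ContinuousLinearMap.adjoint_inner_right, h,
    inner_smul_left, inner_smul_right, orthonormal_iff_ite.1 b.orthonormal m n]
  split_ifs with hmn
  · rw [hmn, map_pow]
  · simp

/-- Covariance is checked on matrix entries: conjugation by `U(t)` multiplies entry `(m, n)` by
`t^m` times the conjugate of `t^n`, exactly as rotating the set does to the angular integral. -/
theorem isPhaseObservable_waveObservable : IsPhaseObservable b (waveObservable b hη) := by
  refine ⟨isObservable_waveObservable b hη, fun t X => clm_ext_inner_basis b fun m n => ?_⟩
  rw [ContinuousLinearMap.comp_apply, ContinuousLinearMap.comp_apply,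
    ← ContinuousLinearMap.adjoint_inner_left, adjoint_numberRep_apply_basis,
    adjoint_numberRep_apply_basis, map_smul, inner_smul_left, inner_smul_right,
    inner_basis_waveObservable, inner_basis_waveObservable, phaseIntegral_rotate, map_pow,
    Complex.conj_conj]
  ring

theorem isPhaseMatrix_gram {η : ℕ → K} (hη : ∀ n, ‖η n‖ = 1) :
    IsPhaseMatrix (Matrix.gram ℂ η) := by
  refine ⟨⟨Matrix.isHermitian_gram ℂ η, fun x => ?_⟩, fun n => ?_⟩
  · have e : (x.sum fun i xi => x.sum fun j xj => star xi * Matrix.gram ℂ η i j * xj) =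
        inner ℂ (x.sum fun i xi => xi • η i) (x.sum fun i xi => xi • η i) := by
      simp only [Finsupp.sum]
      rw [sum_inner]
      refine Finset.sum_congr rfl fun i _ => ?_
      rw [inner_sum]
      refine Finset.sum_congr rfl fun j _ => ?_
      rw [inner_smul_left, inner_smul_right, Matrix.gram_apply, RCLike.star_def]
      ring
    rw [e, inner_self_eq_norm_sq_to_K, ← RCLike.ofReal_pow]
    exact RCLike.ofReal_nonneg.2 (sq_nonneg _)
  · rw [Matrix.gram_apply, inner_self_eq_norm_sq_to_K, hη]
    simp

theorem hasPhaseMatrix_waveObservable :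
    HasPhaseMatrix b (waveObservable b hη) (Matrix.gram ℂ η) :=
  ⟨isPhaseMatrix_gram hη, fun X m n => inner_basis_waveObservable b hη X m n⟩

end Wave

/-! ### Real phase matrices and non-extremality -/

/-- The open upper half circle works. It is needed to recover the entry `c_{0,1}` from the
observable. -/
theorem exists_phaseIntegral_ne_zero : ∃ X : BorelSet, phaseIntegral X 0 1 ≠ 0 := by
  have ho : IsOpen {t : Circle | 0 < (t : ℂ).im} :=
    isOpen_lt continuous_const (Complex.continuous_im.comp continuous_subtype_val)
  have ha : argSet ⟨{t : Circle | 0 < (t : ℂ).im}, ho.measurableSet⟩ = Set.Ioo 0 Real.pi := by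
    ext θ
    simp only [argSet, Set.mem_ofPred_eq, Set.mem_Ico, Set.mem_Ioo, Circle.coe_exp,
      Complex.exp_ofReal_mul_I_im]
    constructor
    · rintro ⟨⟨h0, h2⟩, h3⟩
      refine ⟨lt_of_le_of_ne h0 fun h => ?_, not_le.1 fun h => ?_⟩
      · rw [← h, Real.sin_zero] at h3
        exact lt_irrefl _ h3
      · have h4 := Real.sin_nonneg_of_nonneg_of_le_pi (x := θ - Real.pi) (by linarith)
          (by linarith)
        rw [Real.sin_sub_pi] at h4
        linarith
    · rintro ⟨h0, h1⟩
      exact ⟨⟨h0.le, by linarith [Real.pi_pos]⟩, Real.sin_pos_of_pos_of_lt_pi h0 h1⟩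
  refine ⟨⟨_, ho.measurableSet⟩, ?_⟩
  rw [phaseIntegral, ha, ← integral_Ioc_eq_integral_Ioo,
    ← intervalIntegral.integral_of_le Real.pi_pos.le, integral_exp_mul_complex (by simp)]
  have e : Complex.I * (((0 : ℕ) : ℂ) - ((1 : ℕ) : ℂ)) * (Real.pi : ℂ) =
      -(Real.pi * Complex.I) := by push_cast; ring
  rw [e, Complex.exp_neg, Complex.exp_pi_mul_I]
  norm_num

section Twist

variable {K : Type*} [NormedAddCommGroup K] [InnerProductSpace ℂ K]

/-- Twisting the components of real vectors along an orthonormal pair changes their Gram matrix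
by an imaginary antisymmetric one. -/
theorem inner_add_smul_twist {e₁ e₂ u v : K} {σ x x' y y' : ℂ} (hσ : conj σ = -σ)
    (hσ2 : σ * σ = -1) (h1 : ‖e₁‖ = 1) (h2 : ‖e₂‖ = 1) (h12 : inner ℂ e₁ e₂ = 0)
    (hx : inner ℂ e₁ u = x) (hy : inner ℂ e₂ u = y)
    (hx' : inner ℂ e₁ v = x') (hy' : inner ℂ e₂ v = y') (hxc : conj x = x) (hyc : conj y = y) :
    inner ℂ (u + y • (σ • e₁ - e₂)) (v + y' • (σ • e₁ - e₂)) =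
      inner ℂ u v + σ * (x * y' - y * x') := by
  have h21 : inner ℂ e₂ e₁ = 0 := by rw [← inner_conj_symm, h12, map_zero]
  have hxs : inner ℂ u e₁ = x := by rw [← inner_conj_symm, hx, hxc]
  have hys : inner ℂ u e₂ = y := by rw [← inner_conj_symm, hy, hyc]
  have h1' : inner ℂ e₁ e₁ = (1 : ℂ) := by rw [inner_self_eq_norm_sq_to_K, h1]; simp
  have h2' : inner ℂ e₂ e₂ = (1 : ℂ) := by rw [inner_self_eq_norm_sq_to_K, h2]; simp
  simp only [inner_add_left, inner_add_right, inner_sub_left, inner_sub_right, inner_smul_left,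
    inner_smul_right, h12, h21, hxs, hys, hx', hy', h1', h2', hσ, hyc]
  -- The twist replaces components `(x, y)` along `(e₁, e₂)` by `(x + σy, 0)`. Since `σ` is
  -- imaginary with square `-1`, `(x - σy)(x' + σy') = xx' + yy' + σ(xy' - yx')`.
  linear_combination (-y * y') * hσ2

variable [CompleteSpace K]

/-- A phase observable with real phase matrix of rank at least two is not extreme. -/
theorem waveObservable_notMem_extremePoints (b : HilbertBasis ℕ ℂ H) {η : ℕ → K}
    (hη : ∀ n, ‖η n‖ = 1) (hreal : ∀ m n, conj (inner ℂ (η m) (η n)) = inner ℂ (η m) (η n))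
    (hne : η 1 - (inner ℂ (η 0) (η 1) : ℂ) • η 0 ≠ 0) :
    waveObservable b hη ∉ Set.extremePoints ℝ (phaseObservables b) := by
  -- Gram–Schmidt: `η 0` and the normalized `w` form the orthonormal pair along which the vectors
  -- are twisted.
  set w := η 1 - (inner ℂ (η 0) (η 1) : ℂ) • η 0 with hw
  set e := ((‖w‖ : ℂ)⁻¹) • w with he
  have hwn : (‖w‖ : ℂ) ≠ 0 := by exact_mod_cast norm_ne_zero_iff.2 hne
  have h0 : inner ℂ (η 0) (η 0) = (1 : ℂ) := by rw [inner_self_eq_norm_sq_to_K, hη]; simp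
  have h0w : inner ℂ (η 0) w = 0 := by
    rw [hw, inner_sub_right, inner_smul_right, h0, mul_one, sub_self]
  have h0e : inner ℂ (η 0) e = 0 := by rw [he, inner_smul_right, h0w, mul_zero]
  have hen : ‖e‖ = 1 := by
    rw [he, norm_smul, norm_inv, Complex.norm_real, norm_norm,
      inv_mul_cancel₀ (norm_ne_zero_iff.2 hne)]
  -- The vector `e` is a real combination of `η 0` and `η 1`, so its inner products with all `η n`
  -- inherit reality from the Gram matrix.
  have hye : ∀ n, conj (inner ℂ e (η n)) = inner ℂ e (η n) := fun n => by
    rw [he, hw, inner_smul_left, inner_sub_left, inner_smul_left, hreal 0 1]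
    simp only [map_mul, map_sub, map_inv₀, Complex.conj_ofReal, hreal]
  have hy0 : inner ℂ e (η 0) = 0 := by rw [← inner_conj_symm, h0e, map_zero]
  have hy1 : inner ℂ e (η 1) ≠ 0 := by
    have h1 : η 1 = w + (inner ℂ (η 0) (η 1) : ℂ) • η 0 := by rw [hw]; abel
    have h2 : inner ℂ e (η 1) = inner ℂ e w := by
      conv_lhs => rw [h1]
      rw [inner_add_right, inner_smul_right, hy0, mul_zero, add_zero]
    rw [h2, he, inner_smul_left, inner_self_eq_norm_sq_to_K]
    simpa using hne
  let ζ : ℂ → ℕ → K := fun σ n => η n + (inner ℂ e (η n) : ℂ) • (σ • η 0 - e)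
  have hζ : ∀ σ : ℂ, conj σ = -σ → σ * σ = -1 → ∀ m n, inner ℂ (ζ σ m) (ζ σ n) =
      inner ℂ (η m) (η n) + σ * (inner ℂ (η 0) (η m) * inner ℂ e (η n) -
        inner ℂ e (η m) * inner ℂ (η 0) (η n)) := fun σ hσ hσ2 m n =>
    inner_add_smul_twist hσ hσ2 (hη 0) hen h0e rfl rfl rfl rfl (hreal 0 m) (hye m)
  have hζn : ∀ σ : ℂ, conj σ = -σ → σ * σ = -1 → ∀ n, ‖ζ σ n‖ = 1 := fun σ hσ hσ2 n => by
    have h := hζ σ hσ hσ2 n n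
    rw [inner_self_eq_norm_sq_to_K, inner_self_eq_norm_sq_to_K, hη, mul_comm (inner ℂ (η 0) (η n)),
      sub_self, mul_zero, add_zero] at h
    have h' : ‖ζ σ n‖ ^ 2 = 1 := by
      have h2 : ((‖ζ σ n‖ ^ 2 : ℝ) : ℂ) = ((1 ^ 2 : ℝ) : ℂ) := by
        push_cast
        exact_mod_cast h
      rw [Complex.ofReal_inj] at h2
      rw [h2, one_pow]
    exact (pow_eq_one_iff_of_nonneg (norm_nonneg _) two_ne_zero).1 h'
  have hp := hζn Complex.I (by simp) (by simp)
  have hm := hζn (-Complex.I) (by simp) (by simp)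
  intro hext
  -- The perturbations for `σ = I` and `σ = -I` are opposite, so they cancel in the mean.
  have hseg : waveObservable b hη ∈ openSegment ℝ (waveObservable b hp) (waveObservable b hm) := by
    refine ⟨1 / 2, 1 / 2, by norm_num, by norm_num, by norm_num, ?_⟩
    funext X
    refine clm_ext_inner_basis b fun m n => ?_
    rw [Pi.add_apply, Pi.smul_apply, Pi.smul_apply, _root_.add_apply, inner_add_right,
      _root_.smul_apply, _root_.smul_apply, inner_smul_right_eq_smul,
      inner_smul_right_eq_smul, inner_basis_waveObservable, inner_basis_waveObservable,
      inner_basis_waveObservable, hζ Complex.I (by simp) (by simp),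
      hζ (-Complex.I) (by simp) (by simp), Complex.real_smul, Complex.real_smul]
    push_cast
    ring
  have heq := (mem_extremePoints.1 hext).2 _ (isPhaseObservable_waveObservable b hp) _
    (isPhaseObservable_waveObservable b hm) hseg
  -- At entry `(0, 1)` the perturbation is `I * inner ℂ e (η 1)`, because `η 0` has components `(1,
  -- 0)`. It is nonzero, so the endpoint differs from the midpoint.
  obtain ⟨X, hX⟩ := exists_phaseIntegral_ne_zero
  have h1 := inner_basis_waveObservable b hp X 0 1
  rw [heq.1, inner_basis_waveObservable, hζ Complex.I (by simp) (by simp), hy0, h0, one_mul,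
    zero_mul, sub_zero] at h1
  have hpi : (2 * (Real.pi : ℂ)) ≠ 0 := mul_ne_zero two_ne_zero (by exact_mod_cast Real.pi_ne_zero)
  have h2 := mul_right_cancel₀ (div_ne_zero hX hpi) h1
  exact mul_ne_zero Complex.I_ne_zero hy1 (by linear_combination -h2)

end Twist

/-! ### The radial vectors and their linear independence -/

/-- Lebesgue measure on `(0, ∞)`. -/
def radialMeasure : Measure ℝ := volume.restrict (Set.Ioi 0)

/-- The function `r ↦ √(2r) e^{-r²/2} p(r)`. -/
def gaussPolyFun (p : ℂ[X]) (r : ℝ) : ℂ :=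
  ((Real.sqrt (2 * r) * Real.exp (-(r ^ 2 / 2)) : ℝ) : ℂ) * p.eval (r : ℂ)

theorem memLp_gaussPolyFun (p : ℂ[X]) : MemLp (gaussPolyFun p) 2 radialMeasure := by
  induction p using Polynomial.induction_on' with
  | add p q hp hq =>
    refine (hp.add hq).ae_eq (Eventually.of_forall fun r => ?_)
    simp [gaussPolyFun, mul_add]
  | monomial n a =>
    have hc : Continuous (gaussPolyFun (Polynomial.monomial n a)) := by
      unfold gaussPolyFun
      fun_prop
    rw [memLp_two_iff_integrable_sq_norm hc.aestronglyMeasurable]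
    refine ((integrable_exp_neg_sq_mul_polynomial
      (Polynomial.C (2 * ‖a‖ ^ 2) * Polynomial.X ^ (2 * n + 1))).integrableOn
        (s := Set.Ioi 0)).congr ?_
    filter_upwards [ae_restrict_mem measurableSet_Ioi] with r hr
    have hr' : (0 : ℝ) ≤ 2 * r := by linarith [Set.mem_Ioi.1 hr]
    rw [gaussPolyFun, norm_mul, Complex.norm_real, norm_mul, mul_pow, mul_pow,
      Real.norm_of_nonneg (Real.sqrt_nonneg _), Real.sq_sqrt hr',
      Real.norm_of_nonneg (Real.exp_pos _).le, ← Real.exp_nat_mul, Polynomial.eval_monomial,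
      norm_mul, norm_pow, Complex.norm_real, mul_pow, ← pow_mul, mul_comm n 2, pow_mul ‖r‖,
      Real.norm_eq_abs, sq_abs, show ((2 : ℕ) : ℝ) * -(r ^ 2 / 2) = -r ^ 2 by push_cast; ring]
    simp only [Polynomial.eval_mul, Polynomial.eval_C, Polynomial.eval_pow, Polynomial.eval_X]
    ring

/-- Polynomials, weighted by `√(2r) e^{-r²/2}`, as square integrable functions on `(0, ∞)`. -/
def gaussPoly : ℂ[X] →ₗ[ℂ] Lp ℂ 2 radialMeasure where
  toFun p := (memLp_gaussPolyFun p).toLp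
  map_add' p q := by
    rw [← MemLp.toLp_add]
    congr 1
    funext r
    simp [gaussPolyFun, mul_add]
  map_smul' c p := by
    rw [RingHom.id_apply, ← MemLp.toLp_const_smul]
    congr 1
    funext r
    simp [gaussPolyFun]
    ring

theorem coeFn_gaussPoly (p : ℂ[X]) : ⇑(gaussPoly p) =ᵐ[radialMeasure] gaussPolyFun p :=
  (memLp_gaussPolyFun p).coeFn_toLp

/-- Almost everywhere vanishing becomes vanishing on all of `(0, ∞)` by continuity. The weight is
positive there, so the polynomial has infinitely many roots. -/
theorem ker_gaussPoly : LinearMap.ker gaussPoly = ⊥ := by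
  rw [LinearMap.ker_eq_bot']
  intro p hp
  have h1 : gaussPolyFun p =ᵐ[radialMeasure] fun _ => 0 :=
    (coeFn_gaussPoly p).symm.trans (by rw [hp]; exact Lp.coeFn_zero _ _ _)
  have hc : Continuous (gaussPolyFun p) := by
    unfold gaussPolyFun
    fun_prop
  have h2 := Measure.eqOn_open_of_ae_eq h1 isOpen_Ioi hc.continuousOn continuousOn_const
  refine Polynomial.eq_zero_of_infinite_isRoot p (Set.Infinite.mono ?_
    ((Set.Ioi_infinite (0 : ℝ)).image (f := ((↑) : ℝ → ℂ)) Complex.ofReal_injective.injOn))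
  rintro _ ⟨r, hr, rfl⟩
  have h3 := h2 hr
  refine (mul_eq_zero.1 h3).resolve_left ?_
  have : 0 < Real.sqrt (2 * r) * Real.exp (-(r ^ 2 / 2)) :=
    mul_pos (Real.sqrt_pos.2 (by linarith [Set.mem_Ioi.1 hr])) (Real.exp_pos _)
  exact_mod_cast this.ne'

/-- The square integrable function `r ↦ √(2r) ⟨n|D(r)|k⟩`. -/
def radialAmp (n k : ℕ) : Lp ℂ 2 radialMeasure :=
  gaussPoly ((((Real.sqrt n.factorial)⁻¹ * (Real.sqrt k.factorial)⁻¹ : ℝ) : ℂ) • shiftPoly ℂ n k)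

theorem coeFn_radialAmp (n k : ℕ) : ⇑(radialAmp n k) =ᵐ[radialMeasure]
    fun r => ((Real.sqrt (2 * r) * shiftAmp n k r : ℝ) : ℂ) := by
  refine (coeFn_gaussPoly _).trans (Eventually.of_forall fun r => ?_)
  simp only [gaussPolyFun, shiftAmp, Polynomial.eval_smul, smul_eq_mul]
  rw [← map_shiftPoly Complex.ofRealHom, ← Complex.ofRealHom_eq_coe r, Polynomial.eval_map_apply]
  push_cast
  simp
  ring

/-- The overlap of `√(2r) ⟨m|D(r)|k⟩` and `√(2r) ⟨n|D(r)|k⟩`. -/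
def radialOverlap (k m n : ℕ) : ℝ :=
  ∫ r in Set.Ioi (0 : ℝ), 2 * (r * (shiftAmp m k r * shiftAmp n k r))

theorem inner_radialAmp (m n k : ℕ) :
    inner ℂ (radialAmp m k) (radialAmp n k) = (radialOverlap k m n : ℂ) := by
  rw [L2.inner_def, radialOverlap, ← integral_complex_ofReal]
  refine integral_congr_ae ?_
  filter_upwards [coeFn_radialAmp m k, coeFn_radialAmp n k,
    ae_restrict_mem measurableSet_Ioi] with r h1 h2 hr
  have hr' : (0 : ℝ) ≤ 2 * r := by linarith [Set.mem_Ioi.1 hr]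
  rw [h1, h2, RCLike.inner_apply, Complex.conj_ofReal, ← Complex.ofReal_mul]
  congr 1
  linear_combination (shiftAmp m k r * shiftAmp n k r) * Real.mul_self_sqrt hr'

theorem norm_radialAmp (n k : ℕ) : ‖radialAmp n k‖ = 1 := by
  have h : inner ℂ (radialAmp n k) (radialAmp n k) = (1 : ℂ) := by
    rw [inner_radialAmp, radialOverlap, integral_shiftAmp_sq, Complex.ofReal_one]
  rw [@norm_eq_sqrt_re_inner ℂ, h]
  simp

theorem linearIndependent_radialAmp (k : ℕ) :
    LinearIndependent ℂ fun n => radialAmp n k := by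
  refine LinearIndependent.map' (v := fun n =>
    (((Real.sqrt n.factorial)⁻¹ * (Real.sqrt k.factorial)⁻¹ : ℝ) : ℂ) • shiftPoly ℂ n k) ?_
      gaussPoly ker_gaussPoly
  have hu : ∀ n : ℕ, (((Real.sqrt n.factorial)⁻¹ * (Real.sqrt k.factorial)⁻¹ : ℝ) : ℂ) ≠ 0 := by
    intro n
    have h1 : 0 < Real.sqrt n.factorial := Real.sqrt_pos.2 (by exact_mod_cast n.factorial_pos)
    have h2 : 0 < Real.sqrt k.factorial := Real.sqrt_pos.2 (by exact_mod_cast k.factorial_pos)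
    exact_mod_cast (by positivity :
      (0 : ℝ) < (Real.sqrt n.factorial)⁻¹ * (Real.sqrt k.factorial)⁻¹).ne'
  exact (linearIndependent_shiftPoly (R := ℂ) k).units_smul fun n => Units.mk0 _ (hu n)

/-- The Hilbert space of square summable sequences of square integrable functions on `(0, ∞)`. -/
abbrev RadialSpace : Type := lp (fun _ : ℕ => Lp ℂ 2 radialMeasure) 2

section RadialVec

variable {lam : ℕ → ℝ} (h0 : ∀ k, 0 ≤ lam k) (h1 : HasSum lam 1)

theorem memℓp_radialVec (h0 : ∀ k, 0 ≤ lam k) (h1 : HasSum lam 1) (n : ℕ) :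
    Memℓp (fun k => ((Real.sqrt (lam k) : ℝ) : ℂ) • radialAmp n k) 2 := by
  refine memℓp_gen (h1.summable.congr fun k => ?_)
  rw [norm_smul, norm_radialAmp, Complex.norm_real, Real.norm_of_nonneg (Real.sqrt_nonneg _),
    mul_one, ENNReal.toReal_ofNat, Real.rpow_two, Real.sq_sqrt (h0 k)]

/-- The vector with components `√λ_k √(2r) ⟨n|D(r)|k⟩`. -/
def radialVec (n : ℕ) : RadialSpace := ⟨_, memℓp_radialVec h0 h1 n⟩

theorem inner_radialVec (m n : ℕ) : inner ℂ (radialVec h0 h1 m) (radialVec h0 h1 n) =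
    ((∑' k, lam k * radialOverlap k m n : ℝ) : ℂ) := by
  rw [lp.inner_eq_tsum, Complex.ofReal_tsum]
  refine tsum_congr fun k => ?_
  change inner ℂ (((Real.sqrt (lam k) : ℝ) : ℂ) • radialAmp m k)
    (((Real.sqrt (lam k) : ℝ) : ℂ) • radialAmp n k) = _
  rw [inner_smul_left, inner_smul_right, inner_radialAmp, Complex.conj_ofReal, ← mul_assoc,
    ← Complex.ofReal_mul, Real.mul_self_sqrt (h0 k), Complex.ofReal_mul]

theorem norm_radialVec (n : ℕ) : ‖radialVec h0 h1 n‖ = 1 := by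
  have h : inner ℂ (radialVec h0 h1 n) (radialVec h0 h1 n) = (1 : ℂ) := by
    rw [inner_radialVec]
    have e : ∀ k, lam k * radialOverlap k n n = lam k := fun k => by
      rw [radialOverlap, integral_shiftAmp_sq, mul_one]
    simp_rw [e]
    rw [h1.tsum_eq, Complex.ofReal_one]
  rw [@norm_eq_sqrt_re_inner ℂ, h]
  simp

/-- One component with `λ_k ≠ 0` suffices: projecting to it and removing the factor `√λ_k` gives the
independent family `radialAmp · k`. -/
theorem linearIndependent_radialVec : LinearIndependent ℂ (radialVec h0 h1) := by
  obtain ⟨k, hk⟩ : ∃ k, lam k ≠ 0 := by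
    by_contra! h
    rw [funext h] at h1
    exact zero_ne_one (hasSum_zero.unique h1)
  have hk' : ((Real.sqrt (lam k) : ℝ) : ℂ) ≠ 0 := by
    exact_mod_cast (Real.sqrt_pos.2 (lt_of_le_of_ne (h0 k) hk.symm)).ne'
  let L : RadialSpace →ₗ[ℂ] Lp ℂ 2 radialMeasure :=
    { toFun := fun f => (((Real.sqrt (lam k) : ℝ) : ℂ)⁻¹) • f k
      map_add' := fun f g => by rw [lp.coeFn_add, Pi.add_apply, smul_add]
      map_smul' := fun c f => by
        rw [lp.coeFn_smul, Pi.smul_apply, smul_comm, RingHom.id_apply] }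
  refine LinearIndependent.of_comp L ?_
  convert! linearIndependent_radialAmp k using 1
  funext n
  change ((Real.sqrt (lam k) : ℝ) : ℂ)⁻¹ • (((Real.sqrt (lam k) : ℝ) : ℂ) • radialAmp n k) = _
  rw [smul_smul, inv_mul_cancel₀ hk', one_smul]

/-- The Gram matrix of a linearly independent sequence of unit vectors has infinite rank. -/
theorem hasInfiniteRank_gram {K : Type} [NormedAddCommGroup K] [InnerProductSpace ℂ K]
    [CompleteSpace K] {η : ℕ → K} (hη : ∀ n, ‖η n‖ = 1) (hli : LinearIndependent ℂ η) :
    HasInfiniteRank (Matrix.gram ℂ η) := by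
  -- Totality forces the ambient space to be the closed span of the sequence.
  let S := (Submodule.span ℂ (Set.range η)).topologicalClosure
  let ξ : ℕ → S := fun n =>
    ⟨η n, Submodule.le_topologicalClosure _ (Submodule.subset_span ⟨n, rfl⟩)⟩
  have hS : CompleteSpace S :=
    (Submodule.isClosed_topologicalClosure _).completeSpace_coe
  refine ⟨S, inferInstance, inferInstance, hS, ξ, ⟨hη, ?_, fun m n => rfl⟩, fun hfin => ?_⟩
  · rw [← Submodule.dense_iff_topologicalClosure_eq_top]
    have hr : Submodule.map S.subtype (Submodule.span ℂ (Set.range ξ)) =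
        Submodule.span ℂ (Set.range η) := by
      rw [Submodule.map_span, ← Set.range_comp]
      rfl
    intro x
    rw [closure_subtype]
    have hx : (x : K) ∈ closure (Submodule.span ℂ (Set.range η) : Set K) := x.2
    rw [← hr] at hx
    exact hx
  · have hξ : LinearIndependent ℂ ξ := LinearIndependent.of_comp S.subtype hli
    exact not_finite_iff_infinite.2 inferInstance hξ.finite

end RadialVec

/-! ### The phase space integral between number states -/

/-- A pointwise limit of functions that are bounded in `L¹` is integrable, with the same bound. -/
theorem integrable_of_tendsto_of_integral_norm_le {α E : Type*} [MeasurableSpace α]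
    [NormedAddCommGroup E] {μ : Measure α} {f : ℕ → α → E} {g : α → E} {C : ℝ}
    (hf : ∀ n, Integrable (f n) μ) (hC : ∀ n, ∫ x, ‖f n x‖ ∂μ ≤ C)
    (hlim : ∀ᵐ x ∂μ, Tendsto (fun n => f n x) atTop (𝓝 (g x))) :
    Integrable g μ ∧ ∫ x, ‖g x‖ ∂μ ≤ C := by
  have hC0 : 0 ≤ C := (integral_nonneg fun x => norm_nonneg _).trans (hC 0)
  have hm := aestronglyMeasurable_of_tendsto_ae atTop (fun n => (hf n).1) hlim
  have hle : eLpNorm g 1 μ ≤ ENNReal.ofReal C := by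
    refine (Lp.eLpNorm_lim_le_liminf_eLpNorm (fun n => (hf n).1) g hlim).trans ?_
    refine (liminf_le_liminf (v := fun _ => ENNReal.ofReal C) (Eventually.of_forall fun n => ?_)).trans
      (liminf_const _).le
    rw [eLpNorm_one_eq_lintegral_enorm, ← ofReal_integral_norm_eq_lintegral_enorm (hf n)]
    exact ENNReal.ofReal_le_ofReal (hC n)
  have hg : Integrable g μ := memLp_one_iff_integrable.1 ⟨hm, hle.trans_lt ENNReal.ofReal_lt_top⟩
  refine ⟨hg, ?_⟩
  rw [eLpNorm_one_eq_lintegral_enorm, ← ofReal_integral_norm_eq_lintegral_enorm hg] at hle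
  exact (ENNReal.ofReal_le_ofReal_iff hC0).1 hle

/-- Allows the sum over the eigenvectors of `T` to be exchanged with the phase space integral;
integrability of the limit comes from the uniform `L¹` bound on partial sums. -/
theorem integrable_of_hasSum {α E : Type*} [MeasurableSpace α] [NormedAddCommGroup E]
    [NormedSpace ℝ E] {μ : Measure α} {F : ℕ → α → E} {g : α → E}
    (hF : ∀ n, Integrable (F n) μ) (hs : Summable fun n => ∫ x, ‖F n x‖ ∂μ)
    (hlim : ∀ x, HasSum (fun n => F n x) (g x)) :
    Integrable g μ ∧ HasSum (fun n => ∫ x, F n x ∂μ) (∫ x, g x ∂μ) := by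
  constructor
  · refine (integrable_of_tendsto_of_integral_norm_le (C := ∑' n, ∫ x, ‖F n x‖ ∂μ)
      (f := fun N x => ∑ n ∈ Finset.range N, F n x)
      (fun N => integrable_finsetSum _ fun n _ => hF n) (fun N => ?_)
      (Eventually.of_forall fun x => (hlim x).tendsto_sum_nat)).1
    calc ∫ x, ‖∑ n ∈ Finset.range N, F n x‖ ∂μ
        ≤ ∫ x, ∑ n ∈ Finset.range N, ‖F n x‖ ∂μ :=
          integral_mono (integrable_finsetSum _ fun n _ => hF n).norm
            (integrable_finsetSum _ fun n _ => (hF n).norm) fun x => norm_sum_le _ _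
      _ = ∑ n ∈ Finset.range N, ∫ x, ‖F n x‖ ∂μ := integral_finsetSum _ fun n _ => (hF n).norm
      _ ≤ _ := hs.sum_le_tsum _ fun n _ => integral_nonneg fun x => norm_nonneg _
  · have h := hasSum_integral_of_summable_integral_norm hF hs
    rwa [funext fun x => (hlim x).tsum_eq] at h

section Integrand

variable (b : HilbertBasis ℕ ℂ H) {T : H →L[ℂ] H} {lam : ℕ → ℝ}

theorem hasSum_phaseSpaceIntegrand
    (hT : HasSum (fun n => (lam n : ℂ) • InnerProductSpace.rankOne ℂ (b n) (b n)) T)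
    (φ ψ : H) (p : ℝ × ℝ) :
    HasSum (fun k => (lam k : ℂ) *
        (inner ℂ φ (shift b ((p.2 : ℂ) * Complex.exp (Complex.I * (p.1 : ℂ))) (b k)) *
          inner ℂ (shift b ((p.2 : ℂ) * Complex.exp (Complex.I * (p.1 : ℂ))) (b k)) ψ) * (p.2 : ℂ))
      (phaseSpaceIntegrand b T φ ψ p) := by
  rw [phaseSpaceIntegrand]
  set D := shift b ((p.2 : ℂ) * Complex.exp (Complex.I * (p.1 : ℂ)))
  have h := ((hT.mapL (ContinuousLinearMap.apply ℂ H (ContinuousLinearMap.adjoint D ψ))).mapL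
    D).mapL (innerSL ℂ φ)
  refine (h.mul_right (p.2 : ℂ)).congr_fun fun k => ?_
  simp only [ContinuousLinearMap.apply_apply, InnerProductSpace.rankOne_apply, map_smul, innerSL_apply_apply,
    ContinuousLinearMap.adjoint_inner_right, smul_eq_mul]
  ring

theorem phaseSpaceIntegrand_conj
    (hT : HasSum (fun n => (lam n : ℂ) • InnerProductSpace.rankOne ℂ (b n) (b n)) T)
    (φ ψ : H) (p : ℝ × ℝ) :
    conj (phaseSpaceIntegrand b T φ ψ p) = phaseSpaceIntegrand b T ψ φ p := by
  refine (Complex.hasSum_conj'.2 (hasSum_phaseSpaceIntegrand b hT φ ψ p)).unique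
    ((hasSum_phaseSpaceIntegrand b hT ψ φ p).congr_fun fun k => ?_)
  simp only [map_mul, Complex.conj_ofReal, inner_conj_symm]
  ring

/-- Positivity of `D T D*` in the form `2|xy| ≤ |x|² + |y|²`, applied to each eigenvector of `T`. It
reduces integrability for a pair of vectors to the diagonal case. -/
theorem norm_phaseSpaceIntegrand_le (h0 : ∀ k, 0 ≤ lam k)
    (hT : HasSum (fun n => (lam n : ℂ) • InnerProductSpace.rankOne ℂ (b n) (b n)) T)
    (φ ψ : H) {p : ℝ × ℝ} (hp : 0 < p.2) :
    ‖phaseSpaceIntegrand b T φ ψ p‖ ≤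
      ((phaseSpaceIntegrand b T φ φ p).re + (phaseSpaceIntegrand b T ψ ψ p).re) / 2 := by
  refine (hasSum_phaseSpaceIntegrand b hT φ ψ p).norm_le_of_bounded
    (((Complex.hasSum_re (hasSum_phaseSpaceIntegrand b hT φ φ p)).add
      (Complex.hasSum_re (hasSum_phaseSpaceIntegrand b hT ψ ψ p))).div_const 2) fun k => ?_
  set x := shift b ((p.2 : ℂ) * Complex.exp (Complex.I * (p.1 : ℂ))) (b k)
  have e : ∀ χ : H, ((lam k : ℂ) * (inner ℂ χ x * inner ℂ x χ) * (p.2 : ℂ)).re =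
      lam k * ‖inner ℂ x χ‖ ^ 2 * p.2 := fun χ => by
    have h : inner ℂ χ x * inner ℂ x χ = ((‖inner ℂ x χ‖ ^ 2 : ℝ) : ℂ) := by
      rw [← inner_conj_symm χ x, Complex.conj_mul']
      push_cast
      rfl
    rw [h, ← Complex.ofReal_mul, ← Complex.ofReal_mul, Complex.ofReal_re]
  rw [e, e, norm_mul, norm_mul, norm_mul, Complex.norm_real, Complex.norm_real,
    Real.norm_of_nonneg (h0 k), Real.norm_of_nonneg hp.le, norm_inner_symm φ x]
  have h1 : 0 ≤ lam k * p.2 := mul_nonneg (h0 k) hp.le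
  nlinarith [mul_nonneg h1 (sq_nonneg (‖inner ℂ x φ‖ - ‖inner ℂ x ψ‖))]

theorem tendsto_phaseSpaceIntegrand (T : H →L[ℂ] H) {φ ψ : H} {f g : ℕ → H}
    (hf : Tendsto f atTop (𝓝 φ)) (hg : Tendsto g atTop (𝓝 ψ)) (p : ℝ × ℝ) :
    Tendsto (fun n => phaseSpaceIntegrand b T (f n) (g n) p) atTop
      (𝓝 (phaseSpaceIntegrand b T φ ψ p)) := by
  unfold phaseSpaceIntegrand
  refine Tendsto.mul_const _ (hf.inner ?_)
  exact (ContinuousLinearMap.continuous _).tendsto _ |>.comp hg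

theorem phaseSpaceIntegrand_add_right (T : H →L[ℂ] H) (φ ψ ψ' : H) (p : ℝ × ℝ) :
    phaseSpaceIntegrand b T φ (ψ + ψ') p =
      phaseSpaceIntegrand b T φ ψ p + phaseSpaceIntegrand b T φ ψ' p := by
  simp only [phaseSpaceIntegrand, map_add, inner_add_right, add_mul]

theorem phaseSpaceIntegrand_smul_right (T : H →L[ℂ] H) (φ ψ : H) (c : ℂ) (p : ℝ × ℝ) :
    phaseSpaceIntegrand b T φ (c • ψ) p = c * phaseSpaceIntegrand b T φ ψ p := by
  simp only [phaseSpaceIntegrand, map_smul, inner_smul_right, mul_assoc]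

/-- Here diagonality of `T` matters: both matrix elements involve the same `k`, so their phases
`e^{∓ikθ}` cancel and each term is a product of a function of `θ` and a function of `r`. -/
theorem hasSum_phaseSpaceIntegrand_basis
    (hT : HasSum (fun n => (lam n : ℂ) • InnerProductSpace.rankOne ℂ (b n) (b n)) T)
    (m n : ℕ) (p : ℝ × ℝ) :
    HasSum (fun k => Complex.exp (Complex.I * ((m : ℂ) - (n : ℂ)) * (p.1 : ℂ)) *
        ((lam k * (p.2 * (shiftAmp m k p.2 * shiftAmp n k p.2)) : ℝ) : ℂ))
      (phaseSpaceIntegrand b T (b m) (b n) p) := by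
  refine (hasSum_phaseSpaceIntegrand b hT (b m) (b n) p).congr_fun fun k => ?_
  have hexp : Complex.exp (Complex.I * (p.1 : ℂ)) = (Circle.exp p.1 : ℂ) := by
    rw [Circle.coe_exp, mul_comm]
  have hu : (Circle.exp p.1 : ℂ) * conj (Circle.exp p.1 : ℂ) = 1 := by
    rw [Complex.mul_conj, Circle.normSq_coe, Complex.ofReal_one]
  have hu' : (Circle.exp p.1 : ℂ) ^ k * conj (Circle.exp p.1 : ℂ) ^ k = 1 := by
    rw [← mul_pow, hu, one_pow]
  rw [← inner_conj_symm _ (b n), hexp, inner_shift b hu, inner_shift b hu,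
    ← circle_exp_pow_mul (Circle.exp p.1) m n p.1 rfl]
  simp only [map_mul, map_pow, Complex.conj_conj, Complex.conj_ofReal, Complex.ofReal_mul]
  linear_combination (-(Circle.exp p.1 : ℂ) ^ m * conj (Circle.exp p.1 : ℂ) ^ n *
    (lam k * (p.2 * (shiftAmp m k p.2 * shiftAmp n k p.2)))) * hu'

theorem restrict_argSet_prod (X : BorelSet) :
    (volume : Measure (ℝ × ℝ)).restrict (argSet X ×ˢ Set.Ioi (0 : ℝ)) =
      (volume.restrict (argSet X)).prod (volume.restrict (Set.Ioi (0 : ℝ))) := by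
  rw [Measure.prod_restrict, Measure.volume_eq_prod]

/-- The point is uniformity in `k`: weighted by the summable `λ_k`, the `L¹` norms of the terms
become summable. -/
theorem integral_abs_shiftAmp_mul_le (m n k : ℕ) :
    ∫ r in Set.Ioi (0 : ℝ), ‖r * (shiftAmp m k r * shiftAmp n k r)‖ ≤ 1 := by
  have h := fun m => (((integrable_shiftAmp_mul m k m k).const_mul 2).integrableOn
    (s := Set.Ioi (0 : ℝ))).const_mul (1 / 2)
  have hs : ∫ r in Set.Ioi (0 : ℝ), (1 / 2 * (2 * (r * (shiftAmp m k r * shiftAmp m k r))) +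
      1 / 2 * (2 * (r * (shiftAmp n k r * shiftAmp n k r)))) = 1 := by
    rw [integral_add (h m) (h n), integral_const_mul (1 / 2 : ℝ), integral_const_mul (1 / 2 : ℝ), integral_shiftAmp_sq,
      integral_shiftAmp_sq]
    norm_num
  rw [← hs]
  refine setIntegral_mono_on (integrable_shiftAmp_mul m k n k).integrableOn.norm
    ((h m).add (h n)) measurableSet_Ioi fun r hr => ?_
  have hr' : (0 : ℝ) < r := hr
  rw [norm_mul, Real.norm_of_nonneg hr'.le, norm_mul]
  have e := fun m => abs_mul_abs_self (shiftAmp m k r)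
  simp only [Real.norm_eq_abs]
  rw [← e m, ← e n]
  nlinarith [mul_nonneg hr'.le (sq_nonneg (|shiftAmp m k r| - |shiftAmp n k r|)),
    mul_nonneg hr'.le (sq_nonneg (|shiftAmp m k r|)),
    mul_nonneg hr'.le (sq_nonneg (|shiftAmp n k r|))]

theorem phaseSpaceIntegrand_basis (h0 : ∀ k, 0 ≤ lam k) (h1 : HasSum lam 1)
    (hT : HasSum (fun n => (lam n : ℂ) • InnerProductSpace.rankOne ℂ (b n) (b n)) T)
    (X : BorelSet) (m n : ℕ) :
    IntegrableOn (phaseSpaceIntegrand b T (b m) (b n)) (argSet X ×ˢ Set.Ioi (0 : ℝ)) ∧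
    inner ℂ (b m) (waveObservable b (norm_radialVec h0 h1) X (b n)) = (Real.pi : ℂ)⁻¹ *
      ∫ p in argSet X ×ˢ Set.Ioi (0 : ℝ), phaseSpaceIntegrand b T (b m) (b n) p := by
  rw [IntegrableOn, restrict_argSet_prod]
  have hfin : IsFiniteMeasure (volume.restrict (argSet X)) := by
    rw [← angleMeasure_restrict]
    infer_instance
  have hang : Integrable (fun θ : ℝ => Complex.exp (Complex.I * ((m : ℂ) - (n : ℂ)) * (θ : ℂ)))
      (volume.restrict (argSet X)) := by
    refine Integrable.of_bound (Continuous.aestronglyMeasurable (by fun_prop)) 1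
      (Eventually.of_forall fun θ => ?_)
    rw [Complex.norm_exp]
    simp
  have hrad : ∀ k, Integrable (fun r : ℝ =>
      ((lam k * (r * (shiftAmp m k r * shiftAmp n k r)) : ℝ) : ℂ))
      (volume.restrict (Set.Ioi (0 : ℝ))) := fun k =>
    ((integrable_shiftAmp_mul m k n k).integrableOn.const_mul (lam k)).ofReal
  set A := ∫ θ in argSet X, ‖Complex.exp (Complex.I * ((m : ℂ) - (n : ℂ)) * (θ : ℂ))‖ with hA
  have hsum : Summable fun k => ∫ p : ℝ × ℝ,
      ‖Complex.exp (Complex.I * ((m : ℂ) - (n : ℂ)) * (p.1 : ℂ)) *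
        ((lam k * (p.2 * (shiftAmp m k p.2 * shiftAmp n k p.2)) : ℝ) : ℂ)‖
          ∂((volume.restrict (argSet X)).prod (volume.restrict (Set.Ioi (0 : ℝ)))) := by
    refine Summable.of_nonneg_of_le (fun k => integral_nonneg fun p => norm_nonneg _) (fun k => ?_)
      (h1.summable.mul_left A)
    simp only [norm_mul (Complex.exp _)]
    rw [integral_prod_mul (fun θ : ℝ => ‖Complex.exp (Complex.I * ((m : ℂ) - (n : ℂ)) * (θ : ℂ))‖)
      (fun r : ℝ => ‖((lam k * (r * (shiftAmp m k r * shiftAmp n k r)) : ℝ) : ℂ)‖), ← hA]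
    refine mul_le_mul_of_nonneg_left ?_ (integral_nonneg fun p => norm_nonneg _)
    simp only [Complex.norm_real]
    simp only [norm_mul (lam k), Real.norm_of_nonneg (h0 k)]
    rw [integral_const_mul]
    exact mul_le_of_le_one_right (h0 k) (integral_abs_shiftAmp_mul_le m n k)
  obtain ⟨hi, hs⟩ := integrable_of_hasSum (fun k => hang.mul_prod (hrad k)) hsum
    (hasSum_phaseSpaceIntegrand_basis b hT m n)
  refine ⟨hi, ?_⟩
  -- The halves turn the prefactor `1/π` of the integral formula into the `1/(2π)` of the phase
  -- matrix, as `radialOverlap` is taken with weight `2r`.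
  have hs' : HasSum (fun k => phaseIntegral X m n * ((lam k * radialOverlap k m n / 2 : ℝ) : ℂ))
      (∫ p, phaseSpaceIntegrand b T (b m) (b n) p
        ∂((volume.restrict (argSet X)).prod (volume.restrict (Set.Ioi (0 : ℝ))))) := by
    refine hs.congr_fun fun k => ?_
    rw [integral_prod_mul (fun θ : ℝ => Complex.exp (Complex.I * ((m : ℂ) - (n : ℂ)) * (θ : ℂ)))
      (fun r : ℝ => ((lam k * (r * (shiftAmp m k r * shiftAmp n k r)) : ℝ) : ℂ)),
      integral_complex_ofReal, integral_const_mul, phaseIntegral, radialOverlap, integral_const_mul]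
    congr 2
    ring
  rw [← hs'.tsum_eq, tsum_mul_left, ← Complex.ofReal_tsum, tsum_div_const,
    inner_basis_waveObservable, inner_radialVec]
  push_cast
  ring

end Integrand

/-! ### Extension from number states to all vectors -/

/-- The operator valued set function `E` is weakly given by the phase space integral of `T`
between the vectors `φ` and `ψ`. -/
def IsGeneratedAt (b : HilbertBasis ℕ ℂ H) (T : H →L[ℂ] H) (E : OperatorSetFunction H)
    (φ ψ : H) : Prop :=
  ∀ X : BorelSet,
    IntegrableOn (phaseSpaceIntegrand b T φ ψ) (argSet X ×ˢ Set.Ioi (0 : ℝ)) ∧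
    inner ℂ φ (E X ψ) =
      (Real.pi : ℂ)⁻¹ * ∫ p in argSet X ×ˢ Set.Ioi (0 : ℝ), phaseSpaceIntegrand b T φ ψ p

section

variable {b : HilbertBasis ℕ ℂ H} {T : H →L[ℂ] H} {E : OperatorSetFunction H} {lam : ℕ → ℝ}

theorem IsGeneratedAt.numberVec_right {φ : H} (h : ∀ n, IsGeneratedAt b T E φ (b n))
    (f : ℕ →₀ ℂ) : IsGeneratedAt b T E φ (numberVec b f) := by
  induction f using Finsupp.induction_linear with
  | zero =>
    intro X
    have e : phaseSpaceIntegrand b T φ 0 = fun _ => 0 := by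
      funext p
      simp [phaseSpaceIntegrand]
    simp [e]
  | add f g hf hg =>
    intro X
    have e : phaseSpaceIntegrand b T φ (numberVec b f + numberVec b g) = fun p =>
        phaseSpaceIntegrand b T φ (numberVec b f) p + phaseSpaceIntegrand b T φ (numberVec b g) p :=
      funext fun p => phaseSpaceIntegrand_add_right b T φ _ _ p
    rw [map_add, e]
    refine ⟨(hf X).1.add (hg X).1, ?_⟩
    rw [integral_add (hf X).1 (hg X).1, map_add, inner_add_right, (hf X).2, (hg X).2, mul_add]
  | single n c =>
    intro X
    have e : phaseSpaceIntegrand b T φ (c • b n) = fun p =>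
        c * phaseSpaceIntegrand b T φ (b n) p :=
      funext fun p => phaseSpaceIntegrand_smul_right b T φ _ c p
    rw [numberVec, Finsupp.linearCombination_single, e]
    refine ⟨(h n X).1.const_mul c, ?_⟩
    rw [integral_const_mul, map_smul, inner_smul_right, (h n X).2]
    ring

/-- Hermitian symmetry of both sides. It lets every extension be carried out in the right argument
only. -/
theorem IsGeneratedAt.symm
    (hT : HasSum (fun n => (lam n : ℂ) • InnerProductSpace.rankOne ℂ (b n) (b n)) T)
    (hE : ∀ X, 0 ≤ E X) {φ ψ : H} (h : IsGeneratedAt b T E φ ψ) : IsGeneratedAt b T E ψ φ := by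
  intro X
  have e : phaseSpaceIntegrand b T ψ φ = fun p => conj (phaseSpaceIntegrand b T φ ψ p) :=
    funext fun p => (phaseSpaceIntegrand_conj b hT φ ψ p).symm
  have hs := ((ContinuousLinearMap.nonneg_iff_isPositive _).1 (hE X)).isSelfAdjoint.isSymmetric φ ψ
  rw [e]
  refine ⟨Complex.conjCLE.toContinuousLinearMap.integrable_comp (h X).1, ?_⟩
  rw [integral_conj, ← inner_conj_symm ψ]
  have hs' : inner ℂ (E X φ) ψ = inner ℂ φ (E X ψ) := hs
  rw [hs', (h X).2, map_mul, map_inv₀, Complex.conj_ofReal]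

/-- The integrand is integrable over the phase space for all pairs of vectors, with a bound on the
integral that is uniform on balls. -/
theorem integrable_phaseSpaceIntegrand (h0 : ∀ k, 0 ≤ lam k)
    (hT : HasSum (fun n => (lam n : ℂ) • InnerProductSpace.rankOne ℂ (b n) (b n)) T)
    (hE : E ⟨Set.univ, MeasurableSet.univ⟩ = 1)
    (h : ∀ f g : ℕ →₀ ℂ, IsGeneratedAt b T E (numberVec b f) (numberVec b g)) (φ ψ : H) :
    IntegrableOn (phaseSpaceIntegrand b T φ ψ)
      (argSet ⟨Set.univ, MeasurableSet.univ⟩ ×ˢ Set.Ioi (0 : ℝ)) ∧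
    ∫ p in argSet ⟨Set.univ, MeasurableSet.univ⟩ ×ˢ Set.Ioi (0 : ℝ),
      ‖phaseSpaceIntegrand b T φ ψ p‖ ≤
        Real.pi * (((‖φ‖ + 1) ^ 2 + (‖ψ‖ + 1) ^ 2) / 2) := by
  set S := argSet ⟨Set.univ, MeasurableSet.univ⟩ ×ˢ Set.Ioi (0 : ℝ) with hS
  have hmS : MeasurableSet S := (measurableSet_argSet _).prod measurableSet_Ioi
  -- The approximants are within `1 / (n + 1) ≤ 1` of `χ`, which is the origin of the `+ 1` in the
  -- bound.
  have happ : ∀ χ : H, ∃ f : ℕ → ℕ →₀ ℂ, Tendsto (fun n => numberVec b (f n)) atTop (𝓝 χ) ∧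
      ∀ n, ‖numberVec b (f n)‖ ≤ ‖χ‖ + 1 := by
    intro χ
    choose f hf using fun n : ℕ => (denseRange_numberVec b).exists_dist_lt χ
      (Nat.one_div_pos_of_nat (α := ℝ) (n := n))
    refine ⟨f, ?_, fun n => ?_⟩
    · rw [tendsto_iff_dist_tendsto_zero]
      refine squeeze_zero (fun _ => dist_nonneg) (fun n => ?_)
        (tendsto_one_div_add_atTop_nhds_zero_nat (𝕜 := ℝ))
      rw [dist_comm]
      exact (hf n).le
    · have h1 := hf n
      have h2 : (1 : ℝ) / ((n : ℝ) + 1) ≤ 1 := by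
        rw [div_le_one (by positivity)]
        linarith [(Nat.cast_nonneg n : (0 : ℝ) ≤ n)]
      rw [dist_eq_norm, norm_sub_rev] at h1
      have h3 := norm_add_le χ (numberVec b (f n) - χ)
      rw [add_sub_cancel] at h3
      linarith
  obtain ⟨f, hf, hfb⟩ := happ φ
  obtain ⟨g, hg, hgb⟩ := happ ψ
  -- The normalization `E(𝕋) = 1` gives the exact diagonal integral, which controls the off-diagonal
  -- ones uniformly along the approximation.
  have hdiag : ∀ f : ℕ →₀ ℂ, ∫ p in S,
      (phaseSpaceIntegrand b T (numberVec b f) (numberVec b f) p).re =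
        Real.pi * ‖numberVec b f‖ ^ 2 := by
    intro f
    have h1 := (h f f ⟨Set.univ, MeasurableSet.univ⟩).2
    rw [hE, one_apply_eq_self, inner_self_eq_norm_sq_to_K] at h1
    have hpi : (Real.pi : ℂ) ≠ 0 := by exact_mod_cast Real.pi_ne_zero
    have h2 : ∫ p in S, phaseSpaceIntegrand b T (numberVec b f) (numberVec b f) p =
        ((Real.pi * ‖numberVec b f‖ ^ 2 : ℝ) : ℂ) := by
      rw [eq_inv_mul_iff_mul_eq₀ hpi] at h1
      rw [← h1]
      push_cast
      rfl
    have h3 := integral_re (h f f ⟨Set.univ, MeasurableSet.univ⟩).1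
    simp only [RCLike.re_eq_complex_re] at h3
    rw [h3, h2, Complex.ofReal_re]
  refine integrable_of_tendsto_of_integral_norm_le
    (f := fun n => phaseSpaceIntegrand b T (numberVec b (f n)) (numberVec b (g n)))
    (fun n => (h (f n) (g n) _).1) (fun n => ?_)
    (Eventually.of_forall fun p => tendsto_phaseSpaceIntegrand b T hf hg p)
  have hi : ∀ f : ℕ →₀ ℂ, IntegrableOn (fun p =>
      (phaseSpaceIntegrand b T (numberVec b f) (numberVec b f) p).re) S := fun f =>
    (h f f ⟨Set.univ, MeasurableSet.univ⟩).1.re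
  refine (setIntegral_mono_on (h (f n) (g n) _).1.norm
    (((hi (f n)).add (hi (g n))).div_const 2) hmS fun p hp =>
      norm_phaseSpaceIntegrand_le b h0 hT _ _ hp.2).trans ?_
  simp only [Pi.add_apply]
  rw [integral_div, integral_add (hi (f n)) (hi (g n)), hdiag, hdiag, ← mul_add, mul_div_assoc]
  have h1 := hfb n
  have h2 := hgb n
  gcongr

/-- The bound makes the integral a continuous linear functional of `ψ`, being bounded on the unit
ball. It agrees with the other side on the dense span of the number states. -/
theorem IsGeneratedAt.of_numberVec_right
    (hi : ∀ φ ψ : H, IntegrableOn (phaseSpaceIntegrand b T φ ψ)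
        (argSet ⟨Set.univ, MeasurableSet.univ⟩ ×ˢ Set.Ioi (0 : ℝ)) ∧
      ∫ p in argSet ⟨Set.univ, MeasurableSet.univ⟩ ×ˢ Set.Ioi (0 : ℝ),
        ‖phaseSpaceIntegrand b T φ ψ p‖ ≤
          Real.pi * (((‖φ‖ + 1) ^ 2 + (‖ψ‖ + 1) ^ 2) / 2)) {φ : H}
    (h : ∀ f, IsGeneratedAt b T E φ (numberVec b f)) (ψ : H) : IsGeneratedAt b T E φ ψ := by
  intro X
  have hsub : argSet X ×ˢ Set.Ioi (0 : ℝ) ⊆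
      argSet ⟨Set.univ, MeasurableSet.univ⟩ ×ˢ Set.Ioi (0 : ℝ) :=
    Set.prod_mono (fun θ hθ => ⟨hθ.1, trivial⟩) subset_rfl
  have hX : ∀ ψ, IntegrableOn (phaseSpaceIntegrand b T φ ψ) (argSet X ×ˢ Set.Ioi (0 : ℝ)) :=
    fun ψ => (hi φ ψ).1.mono_set hsub
  refine ⟨hX ψ, ?_⟩
  let L : H →ₗ[ℂ] ℂ :=
    { toFun := fun ψ => ∫ p in argSet X ×ˢ Set.Ioi (0 : ℝ), phaseSpaceIntegrand b T φ ψ p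
      map_add' := fun ψ ψ' => by
        simp only [phaseSpaceIntegrand_add_right]
        exact integral_add (hX ψ) (hX ψ')
      map_smul' := fun c ψ => by
        simp only [phaseSpaceIntegrand_smul_right, RingHom.id_apply, smul_eq_mul]
        exact integral_const_mul c _ }
  have hL : ∀ ψ ∈ Metric.closedBall (0 : H) 1, ‖L ψ‖ ≤
      Real.pi * (((‖φ‖ + 1) ^ 2 + (1 + 1) ^ 2) / 2) := by
    intro ψ hψ
    rw [mem_closedBall_zero_iff] at hψ
    refine (norm_integral_le_integral_norm _).trans ((setIntegral_mono_set (hi φ ψ).1.norm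
      (Eventually.of_forall fun p => norm_nonneg _) hsub.eventuallyLE).trans
        ((hi φ ψ).2.trans ?_))
    gcongr
  have hc : Continuous L := AddMonoidHomClass.continuous_of_bound L _
    (LinearMap.bound_of_ball_bound' one_pos _ L hL)
  refine (denseRange_numberVec b).induction_on (p := fun ψ =>
    inner ℂ φ (E X ψ) = (Real.pi : ℂ)⁻¹ * L ψ) ψ (isClosed_eq (by fun_prop) (by fun_prop))
      fun f => (h f X).2

end

theorem isGeneratedBy_waveObservable (b : HilbertBasis ℕ ℂ H) {T : H →L[ℂ] H} {lam : ℕ → ℝ}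
    (h0 : ∀ k, 0 ≤ lam k) (h1 : HasSum lam 1)
    (hT : HasSum (fun n => (lam n : ℂ) • InnerProductSpace.rankOne ℂ (b n) (b n)) T) :
    IsGeneratedBy b T (waveObservable b (norm_radialVec h0 h1)) := by
  have hE := isObservable_waveObservable b (norm_radialVec h0 h1)
  have hb : ∀ m n, IsGeneratedAt b T (waveObservable b (norm_radialVec h0 h1)) (b m) (b n) :=
    fun m n X => phaseSpaceIntegrand_basis b h0 h1 hT X m n
  have hfin : ∀ f g : ℕ →₀ ℂ, IsGeneratedAt b T (waveObservable b (norm_radialVec h0 h1))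
      (numberVec b f) (numberVec b g) := fun f g =>
    IsGeneratedAt.numberVec_right (fun n => (IsGeneratedAt.numberVec_right
      (fun m => (hb m n).symm hT hE.nonneg) f).symm hT hE.nonneg) g
  have hi := integrable_phaseSpaceIntegrand h0 hT hE.univ hfin
  intro X φ ψ
  exact IsGeneratedAt.of_numberVec_right hi (fun g => (IsGeneratedAt.of_numberVec_right hi
    (fun f => (hfin f g).symm hT hE.nonneg) φ).symm hT hE.nonneg) ψ X

end

end PhaseObs

theorem mainTheorem10 {H : Type*} [NormedAddCommGroup H] [InnerProductSpace ℂ H] [CompleteSpace H]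
    (b : HilbertBasis ℕ ℂ H) (T : H →L[ℂ] H) (hT : T ∈ PhaseObs.diagonalStates b) :
    PhaseObs.IsGeneratedBy b T (PhaseObs.generatedObservable b T) ∧
    PhaseObs.generatedObservable b T ∈ PhaseObs.phaseObservables b ∧
    PhaseObs.generatedObservable b T ∉ Set.extremePoints ℝ (PhaseObs.phaseObservables b) ∧
    ∃ c : Matrix ℕ ℕ ℂ, PhaseObs.HasPhaseMatrix b (PhaseObs.generatedObservable b T) c ∧
      (∀ m n, (c m n).im = 0) ∧ PhaseObs.HasInfiniteRank c := by
  obtain ⟨lam, h0, h1, hT⟩ := hT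
  have hgen := PhaseObs.isGeneratedBy_waveObservable b h0 h1 hT
  have hex : PhaseObs.IsGeneratedBy b T (PhaseObs.generatedObservable b T) :=
    Classical.epsilon_spec (p := PhaseObs.IsGeneratedBy b T) ⟨_, hgen⟩
  have hη := PhaseObs.norm_radialVec h0 h1
  have hli := PhaseObs.linearIndependent_radialVec h0 h1
  refine ⟨hex, ?_⟩
  -- The integral formula determines the observable, so the chosen one may be replaced by the
  -- explicit one.
  rw [hex.unique hgen]
  refine ⟨PhaseObs.isPhaseObservable_waveObservable b hη,
    PhaseObs.waveObservable_notMem_extremePoints b hη (fun m n => ?_) (fun h => ?_),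
    Matrix.gram ℂ (PhaseObs.radialVec h0 h1), PhaseObs.hasPhaseMatrix_waveObservable b hη,
    fun m n => ?_, PhaseObs.hasInfiniteRank_gram hη hli⟩
  · rw [PhaseObs.inner_radialVec, Complex.conj_ofReal]
  -- If `η_1` were a multiple of `η_0`, this would be a vanishing linear combination with
  -- coefficient `1` at index `1`.
  · have h2 := linearIndependent_iff.1 hli (Finsupp.single 1 1 - Finsupp.single 0
      (inner ℂ (PhaseObs.radialVec h0 h1 0) (PhaseObs.radialVec h0 h1 1)))
      (by rw [map_sub, Finsupp.linearCombination_single, Finsupp.linearCombination_single,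
        one_smul]; exact h)
    simpa using DFunLike.congr_fun h2 1
  · rw [Matrix.gram_apply, PhaseObs.inner_radialVec, Complex.ofReal_im]
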